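/- Let $\Lambda=\mathbb C[\lambda_{11},\lambda_{21},\lambda_{31},\lambda_{32}]$, let $\sigma_{k1}$ ($k=1,2$) be the $\mathbb C$-automorphism with $\sigma_{k1}(\lambda_{k1})=\lambda_{k1}-1$ fixing the other variables, and let $*$ be the conjugate-linear ring involution of $\Lambda$ ($i^*=-i$) with $\lambda_{21}^*=1-\lambda_{21}$ and $\lambda^*=-\lambda$ for the other three variables; write $\bar\lambda=\lambda^*$. Let $\pi$ interchange $\lambda_{31}$ and $\lambda_{32}$, and let $G=\langle\pi\rangle\times\langle *\rangle$. Let $\mathfrak S$ be the multiplicative set generated by all images of $\pm1,\ \lambda_{21},\ 2\lambda_{21}-1,\ \lambda_{21}\pm\lambda_{11},\ \lambda_{21}\pm\lambda_{31},\ \lambda_{21}\pm\lambda_{32}$ under the group generated by $\sigma_{11},\sigma_{21}$ and $G$, and let $\mathbb L=\mathfrak S^{-1}\Lambda$. Put $$r_{a,b}=(\lambda_a+\lambda_b)(\lambda_a+\bar\lambda_b),\quad \bar r_{a,b}=r_{a,b}^*,\quad h_{21}=\lambda_{21}^2(\lambda_{21}-\bar\lambda_{21})\,\sigma_{21}^{-1}(\lambda_{21}-\bar\lambda_{21}),$$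 $$t_{11}=\tfrac14 r_{11,21},\qquad t_{21}=r_{21,11}r_{21,31}r_{21,32}/h_{21},$$ and, for $\{a,b\}=\{11,21\}$, $$\mu^{xx}_{a,b}=-\frac{r_{b,a}}{r_{a,b}},\quad \mu^{xy}_{a,b}=-\frac{\bar r_{b,a}}{r_{a,b}},\quad \mu^{yx}_{a,b}=-\frac{r_{b,a}}{\bar r_{a,b}},\quad \mu^{yy}_{a,b}=-\frac{\bar r_{b,a}}{\bar r_{a,b}}.$$ Let $\mathfrak A=\mathrm{Alg}_{2,4}$ be the complex RTGW algebra with these parameters: the associative unital $\mathbb C$-algebra generated by $\mathbb L$ and $x_{11},y_{11},x_{21},y_{21}$ with the relations, for $a,b\in\{11,21\}$ and $f\in\mathbb L$, $$x_af=\sigma_a(f)x_a,\quad y_af=\sigma_a^{-1}(f)y_a,\quad y_ax_a=t_a,\quad x_ay_a=\sigma_a(t_a),\quad x_ax_b=\mu^{xx}_{a,b}x_bx_a,\quad y_ay_b=(\mu^{xx}_{a,b})^*y_by_a,$$ where $\mu^{xx}_{a,a}=1$. The group $G$ acts on $\mathfrak A$: $*$ extends to the conjugate-linear ring automorphism exchanging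 $x_a$ and $y_a$, and $\pi$ to the $\mathbb C$-algebra automorphism fixing all $x_a,y_a$. The elements of $\mathfrak A$ fixed by $G$ form a real subalgebra; $\mathfrak A^G$ denotes the complex subalgebra of $\mathfrak A$ generated by it. Put $C=-i\,\dfrac{\lambda_{11}\lambda_{31}\lambda_{32}}{\lambda_{21}(1-\lambda_{21})}$ and $$U_1=x_{11}+y_{11},\qquad U_2=x_{21}+y_{21}+C,$$ $$U_3=(1-\mu^{xx}_{21,11})x_{11}x_{21}+(1-\mu^{yx}_{21,11})x_{11}y_{21}+(1-\mu^{xy}_{21,11})y_{11}x_{21}+(1-\mu^{yy}_{21,11})y_{11}y_{21}-\lambda_{11}^{-1}C\,(x_{11}-y_{11}).$$ **Theorem.** The canonical map $\mathbb L\to\mathfrak A$ is injective, and for $\{a,b\}=\{11,21\}$ $$x_ax_b=\mu^{xx}_{a,b}x_bx_a,\quad y_ay_b=\mu^{yy}_{a,b}y_by_a,\quad x_ay_b=\mu^{xy}_{a,b}y_bx_a,\quad y_ax_b=\mu^{yx}_{a,b}x_by_a.$$ The elements $U_1,U_2,U_3$ are fixed by $G$ and satisfy $[U_1,U_2]=U_3$,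 $[U_3,U_1]=U_2$, $[U_3,U_2]=-U_1$. There is an injective homomorphism of $\mathbb C$-algebras $\psi:U(\mathfrak{so}(3;\mathbb C))\to\mathfrak A^G$ with $L_x\mapsto U_1$, $L_y\mapsto U_2$, $L_z\mapsto U_3$, where $L_x=E_{32}-E_{23}$, $L_y=E_{13}-E_{31}$, $L_z=E_{21}-E_{12}$. Its image is the $\mathbb C$-subalgebra generated by $U_1,U_2,U_3$; it maps the real subalgebra generated by $L_x,L_y,L_z$ into the set of elements fixed by $G$; and it restricts to an isomorphism of Lie algebras from $\mathfrak{so}(3;\mathbb C)$ onto the Lie subalgebra $\mathfrak g_{\mathfrak{so}}(3;\mathbb C)$ of $\mathfrak A$ (with the commutator bracket) generated by $U_1,U_2,U_3$. Moreover the canonical homomorphism $U(\mathfrak g_{\mathfrak{so}}(3;\mathbb C))\to\mathfrak A$ is injective, with image contained in $\mathfrak A^G$. -/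

import Mathlib

/- The bracket of an associative algebra is its commutator. -/
attribute [local instance 100] LieRing.ofAssociativeRing

noncomputable section

namespace RTGW

open MvPolynomial

/-! ### Involuted polynomial rings, shifts and permutations

The index set `{1, …, p}` is `Fin q ⊕ Fin m` with `p = q + m`: the summand `Fin q` carries the
noncommuting variables, the summand `Fin m` is the last block of the storey partition. -/

/-- The polynomial ring `Λ = ℂ[λ₁, …, λ_p]`, `p = q + m`. -/
abbrev Poly (q m : ℕ) : Type := MvPolynomial (Fin q ⊕ Fin m) ℂ

/-- The substitution `λ_i ↦ λ_i + c`, the other variables being fixed. -/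
def translate {q m : ℕ} (i : Fin q ⊕ Fin m) (c : ℂ) : Poly q m →ₐ[ℂ] Poly q m :=
  aeval (fun j => if j = i then X j + C c else X j)

lemma translate_comp {q m : ℕ} (i : Fin q ⊕ Fin m) (c d : ℂ) (h : c + d = 0) :
    (translate i c).comp (translate i d) = AlgHom.id ℂ (Poly q m) := by
  ext j : 1
  by_cases hj : j = i
  · subst hj
    simp only [translate, AlgHom.comp_apply, aeval_X, if_true, map_add, AlgHom.coe_id, id_eq,
      algHom_C, algebraMap_eq]
    rw [add_assoc, ← C_add, h, C_0, add_zero]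
  · simp [translate, hj]

/-- The shift `σ_i`: `σ_i(λ_i) = λ_i - 1`, `σ_i(λ_j) = λ_j` for `j ≠ i`. -/
def shift {q m : ℕ} (i : Fin q ⊕ Fin m) : Poly q m ≃+* Poly q m :=
  (AlgEquiv.ofAlgHom (translate i (-1)) (translate i 1)
    (translate_comp i _ _ (by norm_num)) (translate_comp i _ _ (by norm_num))).toRingEquiv

/-- The semilinear ring homomorphism `λ_i ↦ ζ_i - λ_i`, acting on `ℂ` by conjugation. -/
def starHom {q m : ℕ} (ζ : Fin q ⊕ Fin m → ℕ) : Poly q m →+* Poly q m :=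
  eval₂Hom (C.comp (starRingEnd ℂ)) (fun i => (ζ i : Poly q m) - X i)

lemma starHom_comp {q m : ℕ} (ζ : Fin q ⊕ Fin m → ℕ) :
    (starHom ζ).comp (starHom ζ) = RingHom.id (Poly q m) := by
  apply MvPolynomial.ringHom_ext
  · intro r; simp [starHom]
  · intro i; simp [starHom]

/-- The involution `*` of `Λ`: `λ_i* = ζ_i - λ_i`, and complex conjugation on `ℂ`. -/
def starEquiv {q m : ℕ} (ζ : Fin q ⊕ Fin m → ℕ) : Poly q m ≃+* Poly q m :=
  RingEquiv.ofRingHom (starHom ζ) (starHom ζ) (starHom_comp ζ) (starHom_comp ζ)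

/-- The permutation of the variables given by a pair of permutations of the two summands of the
index set. -/
def permute {q m : ℕ} (g : Equiv.Perm (Fin q) × Equiv.Perm (Fin m)) : Poly q m ≃+* Poly q m :=
  (renameEquiv ℂ (Equiv.sumCongr g.1 g.2)).toRingEquiv

/-- For a map `storey` whose fibres are the blocks `J₁, …, J_r` of `Fin q`, the group
`S₁ × ⋯ × S_r × S_{r+1}` of permutations preserving all the blocks of `Fin q ⊕ Fin m`, the last
block being `Fin m`. -/
def blockGroup {q : ℕ} (m : ℕ) (storey : Fin q → ℕ) :
    Subgroup (Equiv.Perm (Fin q) × Equiv.Perm (Fin m)) where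
  carrier := {g | ∀ i, storey (g.1 i) = storey i}
  mul_mem' := by
    intro a b ha hb i
    simp only [Prod.fst_mul, Equiv.Perm.mul_apply]
    rw [ha, hb]
  one_mem' := by intro i; simp
  inv_mem' := by
    intro a ha i
    have := ha (a.1⁻¹ i)
    simpa using this.symm

/-- Polynomials `±λ_i + c`, `±2λ_i + c`, `±λ_i ± λ_j + c` with `i ≠ j` and `c ∈ ℤ`. -/
def IsDoubleLinear {q m : ℕ} (f : Poly q m) : Prop :=
  (∃ (a c : ℤ) (i : Fin q ⊕ Fin m), a ∈ ({1, -1, 2, -2} : Set ℤ) ∧ f = C (a : ℂ) * X i + C (c : ℂ)) ∨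
  (∃ (a b c : ℤ) (i j : Fin q ⊕ Fin m), a ∈ ({1, -1} : Set ℤ) ∧ b ∈ ({1, -1} : Set ℤ) ∧ i ≠ j ∧
    f = C (a : ℂ) * X i + C (b : ℂ) * X j + C (c : ℂ))

/-- An involuted polynomial ring in `q + m` variables with a storey partition and a stable,
involuted, saturated, double multiplicative set.  Divisors and irreducible factors are taken up to
nonzero scalars. -/
structure Base (q m : ℕ) where
  q_pos : 0 < q
  /-- the blocks `J₁, …, J_r` are the fibres of `storey` on `Fin q`; the last block is `Fin m` -/
  storey : Fin q → ℕ
  storey_mono : Monotone storey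
  ζ : Fin q ⊕ Fin m → ℕ
  ζ_le_one : ∀ i, ζ i ≤ 1
  ζ_left : ∀ i j : Fin q, storey i = storey j → ζ (Sum.inl i) = ζ (Sum.inl j)
  ζ_right : ∀ i j : Fin m, ζ (Sum.inr i) = ζ (Sum.inr j)
  /-- the multiplicative set -/
  S : Submonoid (Poly q m)
  zero_notMem : (0 : Poly q m) ∉ S
  neg_one_mem : (-1 : Poly q m) ∈ S
  shift_map : ∀ i : Fin q, S.map (shift (m := m) (Sum.inl i)).toMonoidHom = S
  star_map : S.map (starEquiv ζ).toMonoidHom = S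
  permute_map : ∀ g ∈ blockGroup m storey, S.map (permute g).toMonoidHom = S
  saturated : ∀ s ∈ S, ∀ f, f ∣ s → ∃ c : ℂ, c ≠ 0 ∧ C c * f ∈ S
  double : ∀ s ∈ S, ∀ f, Irreducible f → f ∣ s → ∃ c : ℂ, c ≠ 0 ∧ IsDoubleLinear (C c * f)

namespace Base

variable {q m : ℕ} (B : Base q m)

/-- The localization `L = S⁻¹Λ`. -/
abbrev L : Type := Localization B.S

/-- The variables of `Λ` as elements of `L`. -/
def lam (k : Fin q ⊕ Fin m) : B.L := algebraMap (Poly q m) B.L (X k)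

/-- The shift `σ_i` on `L`, `i ∈ {1, …, q}`. -/
def σ (i : Fin q) : B.L ≃+* B.L :=
  IsLocalization.ringEquivOfRingEquiv B.L B.L (shift (Sum.inl i)) (B.shift_map i)

/-- The involution `*` on `L`. -/
def inv : B.L ≃+* B.L :=
  IsLocalization.ringEquivOfRingEquiv B.L B.L (starEquiv B.ζ) B.star_map

/-- The action on `L` of the block permutations. -/
def perm (g : blockGroup m B.storey) : B.L ≃+* B.L :=
  IsLocalization.ringEquivOfRingEquiv B.L B.L (permute g.1) (B.permute_map g.1 g.2)

end Base

/-- RTGW datum.  `t i = t_i`, `μ i j = μ^{xx}_{ij}`, and `inv (t i)` is `t̄_i = t_i*`.  The fractions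
in the consistency equations are cleared of their denominators, which are units.  The rule
`* ∘ σ_i ∘ * = σ_i⁻¹` holds automatically, see `Base.inv_σ_inv`. -/
structure Datum (q m : ℕ) extends Base q m where
  t : Fin q → toBase.L
  μ : Fin q → Fin q → toBase.L
  isUnit_t : ∀ i, IsUnit (t i)
  inv_t : ∀ i, toBase.inv (t i) = toBase.σ i (t i)
  μ_mul : ∀ i j, μ i j * μ j i = 1
  μ_self : ∀ i, μ i i = 1
  perm_t : ∀ (g : blockGroup m storey) (i : Fin q), toBase.perm g (t i) = t (g.1.1 i)
  perm_μ : ∀ (g : blockGroup m storey) (i j : Fin q),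
    toBase.perm g (μ i j) = μ (g.1.1 i) (g.1.1 j)
  μ_mul_inv : ∀ i j, μ i j * toBase.inv (μ i j) = 1
  σ_σ_μ : ∀ i j, toBase.σ i (toBase.σ j (μ i j)) = μ i j
  σ_μ : ∀ i j k, k ≠ i → k ≠ j → toBase.σ k (μ i j) = μ i j
  σ_μ_mul_σ_μ : ∀ i j,
    toBase.σ i (μ i j) * toBase.σ j (μ i j) *
        (toBase.inv (t i) * (toBase.σ i).symm (toBase.inv (t j))) =
      (toBase.σ j).symm (toBase.inv (t i)) * toBase.inv (t j)
  σ_μ_mul_σ_symm_μ : ∀ i j,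
    toBase.σ i (μ i j) * (toBase.σ j).symm (μ i j) * (toBase.inv (t i) * t j) =
      (toBase.σ j).symm (toBase.inv (t i)) * toBase.σ i (t j)
  σ_t_mul_σ_t : ∀ i j k, i ≠ j → k ≠ i → k ≠ j →
    toBase.σ i (t j) * toBase.σ k (t j) = t j * toBase.σ i (toBase.σ k (t j))
  σ_t_mul_σ_symm_t : ∀ i j k, i ≠ j → k ≠ i → k ≠ j →
    toBase.σ i (t j) * (toBase.σ k).symm (t j) = t j * toBase.σ i ((toBase.σ k).symm (t j))

/-- Generators of an RTGW algebra: the elements of `L` and the variables `x_i`, `y_i`. -/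
inductive Gen {q m : ℕ} (D : Datum q m) : Type
  | coef (f : D.L)
  | x (i : Fin q)
  | y (i : Fin q)

open FreeAlgebra in
/-- The defining relations of an RTGW algebra.  The first three make the coefficients a `ℂ`-algebra
homomorphism; the last one is the image of the preceding one under the involution. -/
inductive Rel {q m : ℕ} (D : Datum q m) :
    FreeAlgebra ℂ (Gen D) → FreeAlgebra ℂ (Gen D) → Prop
  | coef_add (f g : D.L) :
      Rel D (ι ℂ (Gen.coef (f + g))) (ι ℂ (Gen.coef f) + ι ℂ (Gen.coef g))
  | coef_mul (f g : D.L) :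
      Rel D (ι ℂ (Gen.coef (f * g))) (ι ℂ (Gen.coef f) * ι ℂ (Gen.coef g))
  | coef_scalar (c : ℂ) :
      Rel D (ι ℂ (Gen.coef (algebraMap (Poly q m) D.L (C c))))
        (algebraMap ℂ (FreeAlgebra ℂ (Gen D)) c)
  | x_coef (i : Fin q) (f : D.L) :
      Rel D (ι ℂ (Gen.x i) * ι ℂ (Gen.coef f)) (ι ℂ (Gen.coef (D.σ i f)) * ι ℂ (Gen.x i))
  | y_coef (i : Fin q) (f : D.L) :
      Rel D (ι ℂ (Gen.y i) * ι ℂ (Gen.coef f)) (ι ℂ (Gen.coef ((D.σ i).symm f)) * ι ℂ (Gen.y i))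
  | y_x (i : Fin q) : Rel D (ι ℂ (Gen.y i) * ι ℂ (Gen.x i)) (ι ℂ (Gen.coef (D.t i)))
  | x_y (i : Fin q) : Rel D (ι ℂ (Gen.x i) * ι ℂ (Gen.y i)) (ι ℂ (Gen.coef (D.σ i (D.t i))))
  | x_x (i j : Fin q) :
      Rel D (ι ℂ (Gen.x i) * ι ℂ (Gen.x j))
        (ι ℂ (Gen.coef (D.μ i j)) * (ι ℂ (Gen.x j) * ι ℂ (Gen.x i)))
  | y_y (i j : Fin q) :
      Rel D (ι ℂ (Gen.y i) * ι ℂ (Gen.y j))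
        (ι ℂ (Gen.coef (D.inv (D.μ i j))) * (ι ℂ (Gen.y j) * ι ℂ (Gen.y i)))

/-- The RTGW algebra `𝔄 = Alg_{q,p}(S, G, σ, t, μ)`, `p = q + m`, over `ℂ`. -/
def Alg {q m : ℕ} (D : Datum q m) : Type := RingQuot (Rel D)

namespace Alg

variable {q m : ℕ} (D : Datum q m)

instance : Ring (Alg D) := inferInstanceAs (Ring (RingQuot (Rel D)))

instance : Algebra ℂ (Alg D) := inferInstanceAs (Algebra ℂ (RingQuot (Rel D)))

/-- The quotient map from the free algebra. -/
def mk : FreeAlgebra ℂ (Gen D) →ₐ[ℂ] Alg D := RingQuot.mkAlgHom ℂ (Rel D)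

lemma mk_rel {a b : FreeAlgebra ℂ (Gen D)} (h : Rel D a b) : mk D a = mk D b :=
  RingQuot.mkAlgHom_rel ℂ h

/-- The coefficient homomorphism `ρ : L → 𝔄`. -/
def coef : D.L →+* Alg D where
  toFun f := mk D (FreeAlgebra.ι ℂ (Gen.coef f))
  map_one' := by
    have h := mk_rel D (Rel.coef_scalar (D := D) 1)
    simpa using h
  map_zero' := by
    have h := mk_rel D (Rel.coef_scalar (D := D) 0)
    simpa using h
  map_add' f g := by simpa using mk_rel D (Rel.coef_add f g)
  map_mul' f g := by simpa using mk_rel D (Rel.coef_mul f g)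

/-- The generator `x_i`. -/
def x (i : Fin q) : Alg D := mk D (FreeAlgebra.ι ℂ (Gen.x i))

/-- The generator `y_i`. -/
def y (i : Fin q) : Alg D := mk D (FreeAlgebra.ι ℂ (Gen.y i))

lemma coef_scalar (c : ℂ) :
    coef D (algebraMap (Poly q m) D.L (C c)) = algebraMap ℂ (Alg D) c := by
  have h := mk_rel D (Rel.coef_scalar (D := D) c)
  rw [AlgHom.commutes] at h
  exact h

lemma x_coef (i : Fin q) (f : D.L) : x D i * coef D f = coef D (D.σ i f) * x D i := by
  have h := mk_rel D (Rel.x_coef i f)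
  rw [map_mul, map_mul] at h
  exact h

lemma y_coef (i : Fin q) (f : D.L) : y D i * coef D f = coef D ((D.σ i).symm f) * y D i := by
  have h := mk_rel D (Rel.y_coef i f)
  rw [map_mul, map_mul] at h
  exact h

lemma y_x (i : Fin q) : y D i * x D i = coef D (D.t i) := by
  have h := mk_rel D (Rel.y_x i)
  rw [map_mul] at h
  exact h

lemma x_y (i : Fin q) : x D i * y D i = coef D (D.σ i (D.t i)) := by
  have h := mk_rel D (Rel.x_y i)
  rw [map_mul] at h
  exact h

lemma x_x (i j : Fin q) : x D i * x D j = coef D (D.μ i j) * (x D j * x D i) := by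
  have h := mk_rel D (Rel.x_x i j)
  rw [map_mul, map_mul, map_mul] at h
  exact h

lemma y_y (i j : Fin q) : y D i * y D j = coef D (D.inv (D.μ i j)) * (y D j * y D i) := by
  have h := mk_rel D (Rel.y_y i j)
  rw [map_mul, map_mul, map_mul] at h
  exact h

end Alg

/-- The `s`-semilinear ring homomorphism on a free algebra with given values on the generators. -/
def liftSemi {T A : Type} [Ring A] [Algebra ℂ A] (s : ℂ →+* ℂ) (f : T → A) :
    FreeAlgebra ℂ T →+* A :=
  letI : Algebra ℂ A := ((algebraMap ℂ A).comp s).toAlgebra' fun c a => Algebra.commutes (s c) a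
  (FreeAlgebra.lift ℂ f).toRingHom

lemma liftSemi_ι {T A : Type} [Ring A] [Algebra ℂ A] (s : ℂ →+* ℂ) (f : T → A) (g : T) :
    liftSemi s f (FreeAlgebra.ι ℂ g) = f g := by
  let : Algebra ℂ A := ((algebraMap ℂ A).comp s).toAlgebra' fun c a => Algebra.commutes (s c) a
  exact FreeAlgebra.lift_ι_apply f g

lemma liftSemi_algebraMap {T A : Type} [Ring A] [iA : Algebra ℂ A] (s : ℂ →+* ℂ) (f : T → A)
    (c : ℂ) : liftSemi s f (algebraMap ℂ (FreeAlgebra ℂ T) c) = algebraMap ℂ A (s c) := by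
  let : Algebra ℂ A := ((algebraMap ℂ A).comp s).toAlgebra' fun c a => Algebra.commutes (s c) a
  exact AlgHom.commutes (FreeAlgebra.lift ℂ f) c

namespace Base

variable {q m : ℕ} (B : Base q m)

lemma σ_algebraMap (i : Fin q) (f : Poly q m) :
    B.σ i (algebraMap _ B.L f) = algebraMap _ B.L (shift (Sum.inl i) f) :=
  IsLocalization.ringEquivOfRingEquiv_eq _ _

lemma inv_algebraMap (f : Poly q m) :
    B.inv (algebraMap _ B.L f) = algebraMap _ B.L (starEquiv B.ζ f) :=
  IsLocalization.ringEquivOfRingEquiv_eq _ _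

lemma perm_algebraMap (g : blockGroup m B.storey) (f : Poly q m) :
    B.perm g (algebraMap _ B.L f) = algebraMap _ B.L (permute g.1 f) :=
  IsLocalization.ringEquivOfRingEquiv_eq _ _

/-- Two ring homomorphisms from `L` that agree on scalars and variables are equal. -/
lemma hom_ext {A : Type} [CommRing A] {φ ψ : B.L →+* A}
    (hC : ∀ c : ℂ, φ (algebraMap (Poly q m) B.L (C c)) = ψ (algebraMap (Poly q m) B.L (C c)))
    (hX : ∀ k, φ (B.lam k) = ψ (B.lam k)) : φ = ψ := by
  apply IsLocalization.ringHom_ext B.S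
  apply MvPolynomial.ringHom_ext
  · intro c; exact hC c
  · intro k; exact hX k

lemma shift_C (i : Fin q ⊕ Fin m) (c : ℂ) : shift i (C c : Poly q m) = C c := by
  simp [shift]

lemma shift_X (i k : Fin q ⊕ Fin m) :
    shift i (X k : Poly q m) = if k = i then X k - 1 else X k := by
  simp [shift, translate, sub_eq_add_neg]

lemma shift_symm_X (i k : Fin q ⊕ Fin m) :
    (shift i).symm (X k : Poly q m) = if k = i then X k + 1 else X k := by
  rw [RingEquiv.symm_apply_eq, apply_ite (shift i), map_add, map_one, shift_X]
  split_ifs <;> simp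

lemma star_C (ζ : Fin q ⊕ Fin m → ℕ) (c : ℂ) :
    starEquiv ζ (C c : Poly q m) = C (starRingEnd ℂ c) := by
  simp [starEquiv, starHom]

lemma star_X (ζ : Fin q ⊕ Fin m → ℕ) (k : Fin q ⊕ Fin m) :
    starEquiv ζ (X k : Poly q m) = (ζ k : Poly q m) - X k := by
  simp [starEquiv, starHom]

lemma permute_C (g : Equiv.Perm (Fin q) × Equiv.Perm (Fin m)) (c : ℂ) :
    permute g (C c : Poly q m) = C c := by
  simp [permute]

lemma permute_X (g : Equiv.Perm (Fin q) × Equiv.Perm (Fin m)) (k : Fin q ⊕ Fin m) :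
    permute g (X k : Poly q m) = X (Equiv.sumCongr g.1 g.2 k) := by
  simp [permute]

lemma inv_σ_inv (i : Fin q) (f : B.L) : B.inv (B.σ i (B.inv f)) = (B.σ i).symm f := by
  rw [RingEquiv.eq_symm_apply]
  have : (B.σ i).toRingHom.comp (B.inv.toRingHom.comp ((B.σ i).toRingHom.comp B.inv.toRingHom)) =
      RingHom.id B.L := by
    apply B.hom_ext
    · intro c
      simp [inv_algebraMap, σ_algebraMap, star_C, shift_C]
    · intro k
      simp only [lam, RingEquiv.toRingHom_eq_coe, RingHom.comp_apply, RingHom.coe_coe,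
        inv_algebraMap, σ_algebraMap, star_X, map_sub, map_natCast, shift_X, RingHom.id_apply]
      split_ifs with h
      · simp only [map_sub, map_one, star_X, shift_X, map_natCast, h, if_true]
        ring
      · simp only [map_sub, star_X, shift_X, map_natCast, h, if_false]
        ring
  exact congrArg (fun φ : B.L →+* B.L => φ f) this

lemma inv_inv (f : B.L) : B.inv (B.inv f) = f := by
  have : B.inv.toRingHom.comp B.inv.toRingHom = RingHom.id B.L := by
    apply B.hom_ext
    · intro c
      simp [inv_algebraMap, star_C]
    · intro k
      simp [lam, inv_algebraMap, star_X]
  exact congrArg (fun φ : B.L →+* B.L => φ f) this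

lemma inv_σ (i : Fin q) (f : B.L) : B.inv (B.σ i f) = (B.σ i).symm (B.inv f) := by
  rw [← inv_σ_inv, inv_inv]

lemma inv_σ_symm (i : Fin q) (f : B.L) : B.inv ((B.σ i).symm f) = B.σ i (B.inv f) := by
  rw [← inv_σ_inv, inv_inv]

lemma perm_σ (g : blockGroup m B.storey) (i : Fin q) (f : B.L) :
    B.perm g (B.σ i f) = B.σ (g.1.1 i) (B.perm g f) := by
  have : (B.perm g).toRingHom.comp (B.σ i).toRingHom =
      (B.σ (g.1.1 i)).toRingHom.comp (B.perm g).toRingHom := by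
    apply B.hom_ext
    · intro c
      simp [perm_algebraMap, σ_algebraMap, permute_C, shift_C]
    · intro k
      simp only [lam, RingEquiv.toRingHom_eq_coe, RingHom.comp_apply, RingHom.coe_coe,
        perm_algebraMap, σ_algebraMap, permute_X, shift_X]
      have : (Equiv.sumCongr g.1.1 g.1.2 k = Sum.inl (g.1.1 i)) ↔ k = Sum.inl i := by
        rw [show (Sum.inl (g.1.1 i) : Fin q ⊕ Fin m) =
          Equiv.sumCongr g.1.1 g.1.2 (Sum.inl i) from rfl, Equiv.apply_eq_iff_eq]
      simp only [this]
      split_ifs <;> simp [permute_X]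
  exact congrArg (fun φ : B.L →+* B.L => φ f) this

lemma perm_σ_symm (g : blockGroup m B.storey) (i : Fin q) (f : B.L) :
    B.perm g ((B.σ i).symm f) = (B.σ (g.1.1 i)).symm (B.perm g f) := by
  rw [RingEquiv.eq_symm_apply, ← perm_σ, RingEquiv.apply_symm_apply]

lemma perm_inv (g : blockGroup m B.storey) (f : B.L)
    (hζ : ∀ k, B.ζ (Equiv.sumCongr g.1.1 g.1.2 k) = B.ζ k) :
    B.perm g (B.inv f) = B.inv (B.perm g f) := by
  have : (B.perm g).toRingHom.comp B.inv.toRingHom =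
      B.inv.toRingHom.comp (B.perm g).toRingHom := by
    apply B.hom_ext
    · intro c
      simp [perm_algebraMap, inv_algebraMap, permute_C, star_C]
    · intro k
      simp only [lam, RingEquiv.toRingHom_eq_coe, RingHom.comp_apply, RingHom.coe_coe,
        perm_algebraMap, inv_algebraMap, permute_X, star_X, map_sub, map_natCast, hζ]
  exact congrArg (fun φ : B.L →+* B.L => φ f) this

lemma ζ_perm (g : blockGroup m B.storey) (k : Fin q ⊕ Fin m) :
    B.ζ (Equiv.sumCongr g.1.1 g.1.2 k) = B.ζ k := by
  rcases k with i | i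
  · exact B.ζ_left _ _ (g.2 i)
  · exact B.ζ_right _ _

end Base

namespace Alg

variable {q m : ℕ} (D : Datum q m)

/-- Values of the involution on the generators: `f ↦ f*`, `x_i ↦ y_i`, `y_i ↦ x_i`. -/
def invGen : Gen D → Alg D
  | Gen.coef f => coef D (D.inv f)
  | Gen.x i => y D i
  | Gen.y i => x D i

/-- The involution `*` of `𝔄`: the conjugate-linear ring endomorphism with
`f* = D.inv f` on `L`, `x_i* = y_i`, `y_i* = x_i`. -/
def inv : Alg D →+* Alg D :=
  RingQuot.lift ⟨liftSemi (starRingEnd ℂ) (invGen D), by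
    intro a b h
    cases h with
    | coef_add f g => simp [liftSemi_ι, invGen]
    | coef_mul f g => simp [liftSemi_ι, invGen]
    | coef_scalar c =>
      rw [liftSemi_ι, liftSemi_algebraMap, invGen, D.inv_algebraMap, Base.star_C, coef_scalar]
    | x_coef i f => simp [liftSemi_ι, invGen, y_coef, D.inv_σ]
    | y_coef i f => simp [liftSemi_ι, invGen, x_coef, D.inv_σ_symm]
    | y_x i => simp [liftSemi_ι, invGen, x_y, D.inv_t]
    | x_y i => simp [liftSemi_ι, invGen, y_x, D.inv_t, D.inv_σ]
    | x_x i j => simp only [map_mul, liftSemi_ι, invGen]; exact y_y D i j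
    | y_y i j => simp only [map_mul, liftSemi_ι, invGen, D.inv_inv]; exact x_x D i j⟩

/-- Values of a block permutation on the generators: `x_i ↦ x_{π(i)}`, `y_i ↦ y_{π(i)}`, and the
permutation of the variables `λ_i` on `L`. -/
def permGen (g : blockGroup m D.storey) : Gen D → Alg D
  | Gen.coef f => coef D (D.perm g f)
  | Gen.x i => x D (g.1.1 i)
  | Gen.y i => y D (g.1.1 i)

/-- The action of a block permutation on `𝔄`. -/
def perm (g : blockGroup m D.storey) : Alg D →ₐ[ℂ] Alg D :=
  RingQuot.liftAlgHom ℂ ⟨FreeAlgebra.lift ℂ (permGen D g), by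
    intro a b h
    cases h with
    | coef_add f g => simp [permGen]
    | coef_mul f g => simp [permGen]
    | coef_scalar c =>
      rw [FreeAlgebra.lift_ι_apply, AlgHom.commutes, permGen, D.perm_algebraMap, Base.permute_C,
        coef_scalar]
    | x_coef i f => simp [permGen, x_coef, D.perm_σ]
    | y_coef i f => simp [permGen, y_coef, D.perm_σ_symm]
    | y_x i => simp [permGen, y_x, D.perm_t]
    | x_y i => simp [permGen, x_y, D.perm_t, D.perm_σ]
    | x_x i j =>
      simp only [map_mul, FreeAlgebra.lift_ι_apply, permGen, D.perm_μ]; exact x_x D _ _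
    | y_y i j =>
      simp only [map_mul, FreeAlgebra.lift_ι_apply, permGen, D.perm_inv g _ (D.ζ_perm g), D.perm_μ]
      exact y_y D _ _⟩

lemma inv_algebraMap (c : ℂ) :
    inv D (algebraMap ℂ (Alg D) c) = algebraMap ℂ (Alg D) (starRingEnd ℂ c) := by
  rw [← coef_scalar, ← coef_scalar]
  have h : inv D (mk D (FreeAlgebra.ι ℂ (Gen.coef (algebraMap (Poly q m) D.L (C c))))) =
      coef D (D.inv (algebraMap (Poly q m) D.L (C c))) := by
    have h2 : mk D (FreeAlgebra.ι ℂ (Gen.coef (algebraMap (Poly q m) D.L (C c)))) =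
      RingQuot.mkRingHom (Rel D) (FreeAlgebra.ι ℂ (Gen.coef (algebraMap (Poly q m) D.L (C c)))) := by
      exact congrFun (congrArg DFunLike.coe (RingQuot.mkAlgHom_coe ℂ (Rel D))) _
    rw [h2]
    refine (RingQuot.lift_mkRingHom_apply _ _ _).trans ?_
    exact liftSemi_ι _ _ _
  rw [D.inv_algebraMap, Base.star_C] at h
  exact h

/-- The real subalgebra of `𝔄` of the elements fixed by every element of the group
`G = S × ⟨*⟩`; it is not a complex subspace, as `*` is conjugate-linear. -/
def fixed : Subalgebra ℝ (Alg D) where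
  carrier := {a | inv D a = a ∧ ∀ g, perm D g a = a}
  mul_mem' := by
    rintro a b ⟨ha, ha'⟩ ⟨hb, hb'⟩
    exact ⟨by rw [map_mul, ha, hb], fun g => by rw [map_mul, ha', hb']⟩
  add_mem' := by
    rintro a b ⟨ha, ha'⟩ ⟨hb, hb'⟩
    exact ⟨by rw [map_add, ha, hb], fun g => by rw [map_add, ha', hb']⟩
  algebraMap_mem' := by
    intro r
    have h : algebraMap ℝ (Alg D) r = algebraMap ℂ (Alg D) (r : ℂ) := rfl
    refine ⟨?_, fun g => ?_⟩
    · rw [h, inv_algebraMap, Complex.conj_ofReal]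
    · rw [h, AlgHom.commutes]

/-- The invariant algebra `𝔄^G`, as a complex algebra: the complex subalgebra of `𝔄` generated
(equivalently, spanned) by the elements fixed by `G`. -/
def invariants : Subalgebra ℂ (Alg D) := Algebra.adjoin ℂ (fixed D : Set (Alg D))

end Alg

/-! ### The explicit datum with `q = 2`, `p = 4` -/

namespace So3

/-- `Λ = ℂ[λ₁₁, λ₂₁, λ₃₁, λ₃₂]`. -/
abbrev P : Type := Poly 2 2

/-- The index `11`. -/
abbrev i11 : Fin 2 ⊕ Fin 2 := Sum.inl 0

/-- The index `21`. -/
abbrev i21 : Fin 2 ⊕ Fin 2 := Sum.inl 1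

/-- The index `31`. -/
abbrev i31 : Fin 2 ⊕ Fin 2 := Sum.inr 0

/-- The index `32`. -/
abbrev i32 : Fin 2 ⊕ Fin 2 := Sum.inr 1

/-- The blocks are `{11}`, `{21}`, `{31, 32}`. -/
def storey : Fin 2 → ℕ := ![0, 1]

/-- `ζ₁₁ = 0`, `ζ₂₁ = 1`, `ζ₃₁ = ζ₃₂ = 0`. -/
def ζ : Fin 2 ⊕ Fin 2 → ℕ := Sum.elim ![0, 1] ![0, 0]

/-- The involution on `Λ`. -/
abbrev st : P ≃+* P := starEquiv ζ

/-- The group of ring automorphisms of `Λ` generated by the shifts and by `G = S × ⟨*⟩`. -/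
def H : Subgroup (RingAut P) :=
  Subgroup.closure ({g | ∃ i : Fin 2, g = shift (Sum.inl i)} ∪ {st} ∪
    {g | ∃ e ∈ blockGroup 2 storey, g = permute e})

/-- The generating set `±1`, `λ₂₁`, `2λ₂₁ - 1`, `λ₂₁ ± λ_k`, `k ∈ {11, 31, 32}`. -/
def Ω : Set P :=
  {1, -1, X i21, 2 * X i21 - 1} ∪ {f | ∃ k ∈ ({i11, i31, i32} : Set (Fin 2 ⊕ Fin 2)),
    f = X i21 + X k ∨ f = X i21 - X k}

/-- The orbit of `Ω` under `H`. -/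
def orbit : Set P := {f | ∃ g ∈ H, ∃ ω ∈ Ω, g ω = f}

/-- The multiplicative closure of the orbit of `Ω`. -/
def S : Submonoid P := Submonoid.closure orbit

lemma image_orbit (g : RingAut P) (hg : g ∈ H) : (g : P → P) '' orbit = orbit := by
  ext f
  constructor
  · rintro ⟨_, ⟨g', hg', ω, hω, rfl⟩, rfl⟩
    exact ⟨g * g', H.mul_mem hg hg', ω, hω, rfl⟩
  · rintro ⟨g', hg', ω, hω, rfl⟩
    refine ⟨(g⁻¹ * g') ω, ⟨g⁻¹ * g', H.mul_mem (H.inv_mem hg) hg', ω, hω, rfl⟩, ?_⟩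
    change (g * (g⁻¹ * g')) ω = g' ω
    rw [mul_inv_cancel_left]

lemma map_S (g : RingAut P) (hg : g ∈ H) : S.map (RingEquiv.toMonoidHom g) = S := by
  rw [S, MonoidHom.map_mclosure]
  exact congrArg _ (image_orbit g hg)

lemma apply_mem_S (g : RingAut P) (hg : g ∈ H) {f : P} (hf : f ∈ S) : g f ∈ S := by
  have h := Submonoid.mem_map_of_mem (RingEquiv.toMonoidHom g) hf
  rw [map_S g hg] at h
  exact h

lemma shift_mem_H (i : Fin 2) : (shift (Sum.inl i) : RingAut P) ∈ H :=
  Subgroup.subset_closure (Or.inl (Or.inl ⟨i, rfl⟩))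

lemma st_mem_H : (st : RingAut P) ∈ H := Subgroup.subset_closure (Or.inl (Or.inr rfl))

lemma permute_mem_H {e : Equiv.Perm (Fin 2) × Equiv.Perm (Fin 2)} (he : e ∈ blockGroup 2 storey) :
    (permute e : RingAut P) ∈ H := Subgroup.subset_closure (Or.inr ⟨e, he, rfl⟩)

lemma mem_S_of_Ω {f : P} (hf : f ∈ Ω) : f ∈ S :=
  Submonoid.subset_closure ⟨1, H.one_mem, f, hf, rfl⟩

/-- Ring automorphisms acting on the variables by signs, permutations and integer translations. -/
def IsAffine (g : RingAut P) : Prop :=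
  ∃ (e : Equiv.Perm (Fin 2 ⊕ Fin 2)), ∀ k, ∃ ε n : ℤ, (ε = 1 ∨ ε = -1) ∧
    g (X k) = C (ε : ℂ) * X (e k) + C (n : ℂ)

lemma apply_C_int (g : RingAut P) (n : ℤ) : g (C (n : ℂ)) = C (n : ℂ) := by
  have : (C (n : ℂ) : P) = ((n : ℤ) : P) := by simp
  rw [this, map_intCast]

lemma IsAffine.apply {g : RingAut P} (hg : IsAffine g) {f : P} (hf : IsDoubleLinear f) :
    IsDoubleLinear (g f) := by
  obtain ⟨e, he⟩ := hg
  rcases hf with ⟨a, c, i, ha, rfl⟩ | ⟨a, b, c, i, j, ha, hb, hij, rfl⟩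
  · obtain ⟨ε, n, hε, h⟩ := he i
    refine Or.inl ⟨a * ε, a * n + c, e i, ?_, ?_⟩
    · rcases ha with rfl | rfl | rfl | rfl <;> rcases hε with rfl | rfl <;> simp
    · rw [map_add, map_mul, apply_C_int, apply_C_int, h]
      push_cast
      simp only [C_add, C_mul]
      ring
  · obtain ⟨ε, n, hε, h⟩ := he i
    obtain ⟨ε', n', hε', h'⟩ := he j
    refine Or.inr ⟨a * ε, b * ε', a * n + b * n' + c, e i, e j, ?_, ?_, ?_, ?_⟩
    · rcases ha with rfl | rfl <;> rcases hε with rfl | rfl <;> simp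
    · rcases hb with rfl | rfl <;> rcases hε' with rfl | rfl <;> simp
    · exact fun h => hij (e.injective h)
    · rw [map_add, map_add, map_mul, map_mul, apply_C_int, apply_C_int, apply_C_int, h, h']
      push_cast
      simp only [C_add, C_mul]
      ring

lemma isAffine_shift (i : Fin 2 ⊕ Fin 2) : IsAffine (shift i : RingAut P) := by
  refine ⟨1, fun k => ⟨1, if k = i then -1 else 0, Or.inl rfl, ?_⟩⟩
  change shift i (X k) = _
  rw [Base.shift_X]
  split_ifs <;> simp [sub_eq_add_neg]

lemma isAffine_shift_symm (i : Fin 2 ⊕ Fin 2) : IsAffine (shift i : RingAut P)⁻¹ := by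
  refine ⟨1, fun k => ⟨1, if k = i then 1 else 0, Or.inl rfl, ?_⟩⟩
  change (shift i).symm (X k) = _
  rw [Base.shift_symm_X]
  split_ifs <;> simp

lemma isAffine_st : IsAffine st := by
  refine ⟨1, fun k => ⟨-1, ζ k, Or.inr rfl, ?_⟩⟩
  change starEquiv ζ (X k) = _
  rw [Base.star_X]
  simp
  ring

lemma isAffine_st_inv : IsAffine (st : RingAut P)⁻¹ := by
  have : (st : RingAut P)⁻¹ = st := rfl
  rw [this]
  exact isAffine_st

lemma isAffine_permute (e : Equiv.Perm (Fin 2) × Equiv.Perm (Fin 2)) :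
    IsAffine (permute e : RingAut P) := by
  refine ⟨Equiv.sumCongr e.1 e.2, fun k => ⟨1, 0, Or.inl rfl, ?_⟩⟩
  change permute e (X k) = _
  rw [Base.permute_X]
  simp

lemma isAffine_permute_inv (e : Equiv.Perm (Fin 2) × Equiv.Perm (Fin 2)) :
    IsAffine (permute e : RingAut P)⁻¹ := by
  have : (permute e : RingAut P)⁻¹ = permute e⁻¹ := by
    rw [inv_eq_iff_mul_eq_one]
    apply RingEquiv.ext
    intro f
    change permute e (permute e⁻¹ f) = f
    simp only [permute]
    change renameEquiv ℂ _ (renameEquiv ℂ _ f) = f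
    simp only [renameEquiv_apply, rename_rename]
    have h : (Equiv.sumCongr e.1 e.2 : Fin 2 ⊕ Fin 2 → _) ∘ Equiv.sumCongr e⁻¹.1 e⁻¹.2 = id := by
      funext k
      rcases k with k | k <;> simp
    rw [h, rename_id_apply]
  rw [this]
  exact isAffine_permute _

lemma isDoubleLinear_apply {g : RingAut P} (hg : g ∈ H) :
    (∀ f, IsDoubleLinear f → IsDoubleLinear (g f)) ∧
      ∀ f, IsDoubleLinear f → IsDoubleLinear (g⁻¹ f) := by
  induction hg using Subgroup.closure_induction with
  | mem g hg =>
    rcases hg with (⟨i, rfl⟩ | rfl) | ⟨e, -, rfl⟩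
    · exact ⟨fun f => (isAffine_shift _).apply, fun f => (isAffine_shift_symm _).apply⟩
    · exact ⟨fun f => isAffine_st.apply, fun f => isAffine_st_inv.apply⟩
    · exact ⟨fun f => (isAffine_permute _).apply, fun f => (isAffine_permute_inv _).apply⟩
  | one => exact ⟨fun f hf => hf, fun f hf => hf⟩
  | mul x y _ _ hx hy =>
    refine ⟨fun f hf => hx.1 _ (hy.1 _ hf), fun f hf => ?_⟩
    rw [mul_inv_rev]
    exact hy.2 _ (hx.2 _ hf)
  | inv x _ hx =>
    refine ⟨hx.2, ?_⟩
    rw [inv_inv]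
    exact hx.1

lemma isDoubleLinear_Ω {f : P} (hf : f ∈ Ω) : f = 1 ∨ f = -1 ∨ IsDoubleLinear f := by
  rcases hf with (rfl | rfl | rfl | rfl) | ⟨k, hk, rfl | rfl⟩
  · simp
  · simp
  · exact Or.inr (Or.inr (Or.inl ⟨1, 0, i21, by simp, by simp⟩))
  · refine Or.inr (Or.inr (Or.inl ⟨2, -1, i21, by simp, ?_⟩))
    have h2 : (C (2 : ℂ) : P) = 2 := by simpa using C_eq_coe_nat (σ := Fin 2 ⊕ Fin 2) (R := ℂ) 2
    simp [sub_eq_add_neg, h2]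
  · refine Or.inr (Or.inr (Or.inr ⟨1, 1, 0, i21, k, by simp, by simp, ?_, by simp⟩))
    rcases hk with rfl | rfl | rfl <;> decide
  · refine Or.inr (Or.inr (Or.inr ⟨1, -1, 0, i21, k, by simp, by simp, ?_, ?_⟩))
    · rcases hk with rfl | rfl | rfl <;> decide
    · simp [sub_eq_add_neg]

lemma isDoubleLinear_orbit {f : P} (hf : f ∈ orbit) : IsUnit f ∨ IsDoubleLinear f := by
  obtain ⟨g, hg, ω, hω, rfl⟩ := hf
  rcases isDoubleLinear_Ω hω with rfl | rfl | h
  · left; simp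
  · left; simp
  · exact Or.inr ((isDoubleLinear_apply hg).1 _ h)

lemma IsDoubleLinear_ne_zero {f : P} (hf : IsDoubleLinear f) : f ≠ 0 := by
  rintro rfl
  rcases hf with ⟨a, c, i, ha, h⟩ | ⟨a, b, c, i, j, ha, hb, hij, h⟩
  · have h2 := congrArg (pderiv i) h
    simp at h2
    rcases ha with rfl | rfl | rfl | rfl <;> simp at h2
  · have h2 := congrArg (pderiv i) h
    simp [Ne.symm hij] at h2
    rcases ha with rfl | rfl <;> simp at h2

lemma IsDoubleLinear_totalDegree {f : P} (hf : IsDoubleLinear f) : f.totalDegree ≤ 1 := by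
  have h1 : ∀ (a : ℂ) (i : Fin 2 ⊕ Fin 2), (C a * X i : P).totalDegree ≤ 1 := fun a i =>
    (totalDegree_mul _ _).trans (by rw [totalDegree_C, totalDegree_X])
  have h0 : ∀ a : ℂ, (C a : P).totalDegree ≤ 1 := fun a => by rw [totalDegree_C]; omega
  rcases hf with ⟨a, c, i, -, rfl⟩ | ⟨a, b, c, i, j, -, -, -, rfl⟩
  · exact (totalDegree_add _ _).trans (max_le (h1 _ _) (h0 _))
  · exact (totalDegree_add _ _).trans
      (max_le ((totalDegree_add _ _).trans (max_le (h1 _ _) (h1 _ _))) (h0 _))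

lemma ne_zero_of_mem_S {f : P} (hf : f ∈ S) : f ≠ 0 := by
  induction hf using Submonoid.closure_induction with
  | mem f hf =>
    rcases isDoubleLinear_orbit hf with h | h
    · exact h.ne_zero
    · exact IsDoubleLinear_ne_zero h
  | one => exact one_ne_zero
  | mul f g _ _ hf hg => exact mul_ne_zero hf hg

lemma irreducible_dvd {p s : P} (hp : Irreducible p) (hs : s ∈ S) (h : p ∣ s) :
    ∃ c : ℂ, c ≠ 0 ∧ C c * p ∈ orbit ∧ IsDoubleLinear (C c * p) := by
  induction hs using Submonoid.closure_induction with
  | mem f hf =>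
    rcases isDoubleLinear_orbit hf with h' | h'
    · exact absurd (isUnit_of_dvd_unit h h') hp.not_isUnit
    · obtain ⟨r, rfl⟩ := h
      have hne := IsDoubleLinear_ne_zero h'
      have hd := IsDoubleLinear_totalDegree h'
      have hp0 := left_ne_zero_of_mul hne
      have hr0 := right_ne_zero_of_mul hne
      rw [totalDegree_mul_of_isDomain hp0 hr0] at hd
      have hp1 : p.totalDegree ≠ 0 := by
        intro h0
        rw [totalDegree_eq_zero_iff_eq_C] at h0
        apply hp.not_isUnit
        rw [h0]
        refine IsUnit.map C (IsUnit.mk0 _ ?_)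
        intro h1
        rw [h1, C_0] at h0
        exact hp0 h0
      have hr1 : r.totalDegree = 0 := by omega
      rw [totalDegree_eq_zero_iff_eq_C] at hr1
      refine ⟨coeff 0 r, ?_, ?_, ?_⟩
      · intro h1
        rw [h1, C_0] at hr1
        exact hr0 hr1
      · rw [← hr1, mul_comm]; exact hf
      · rw [← hr1, mul_comm]; exact h'
  | one => exact absurd (isUnit_of_dvd_one h) hp.not_isUnit
  | mul f g _ _ hf hg =>
    rcases hp.prime.dvd_or_dvd h with h | h
    · exact hf h
    · exact hg h

lemma saturated_S (s : P) (hs : s ∈ S) (f : P) (hf : f ∣ s) :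
    ∃ c : ℂ, c ≠ 0 ∧ C c * f ∈ S := by
  induction f using WfDvdMonoid.induction_on_irreducible with
  | zero => exact absurd (zero_dvd_iff.mp hf) (ne_zero_of_mem_S hs)
  | unit u hu =>
    obtain ⟨c, hc, rfl⟩ := MvPolynomial.isUnit_iff_eq_C_of_isReduced.mp hu
    refine ⟨c⁻¹, inv_ne_zero hc.ne_zero, ?_⟩
    rw [← C_mul, inv_mul_cancel₀ hc.ne_zero, C_1]
    exact S.one_mem
  | mul a i _ hi ih =>
    obtain ⟨c, hc, h⟩ := ih ((dvd_mul_left _ _).trans hf)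
    obtain ⟨c', hc', h', -⟩ := irreducible_dvd hi hs ((dvd_mul_right _ _).trans hf)
    refine ⟨c' * c, mul_ne_zero hc' hc, ?_⟩
    rw [C_mul, mul_mul_mul_comm]
    exact S.mul_mem (Submonoid.subset_closure h') h

/-- The involuted polynomial ring `Λ`, its storey partition and the multiplicative set `S`. -/
def base : Base 2 2 where
  q_pos := by norm_num
  storey := storey
  storey_mono := by
    intro i j h
    fin_cases i <;> fin_cases j <;> simp [storey] at h ⊢
  ζ := ζ
  ζ_le_one := by
    rintro (i | i) <;> fin_cases i <;> simp [ζ]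
  ζ_left := by
    intro i j h
    fin_cases i <;> fin_cases j <;> simp [storey, ζ] at h ⊢
  ζ_right := by
    intro i j
    fin_cases i <;> fin_cases j <;> simp [ζ]
  S := S
  zero_notMem := fun h => ne_zero_of_mem_S h rfl
  neg_one_mem := mem_S_of_Ω (by simp [Ω])
  shift_map i := map_S _ (shift_mem_H i)
  star_map := map_S _ st_mem_H
  permute_map _ hg := map_S _ (permute_mem_H hg)
  saturated := saturated_S
  double := fun s hs f hf h => by
    obtain ⟨c, hc, -, h⟩ := irreducible_dvd hf hs h
    exact ⟨c, hc, h⟩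

/-- `r_{k,l} = (λ_k + λ_l)(λ_k + λ_l*)`, used for indices in neighbouring blocks. -/
def rg (k l : Fin 2 ⊕ Fin 2) : P := (X k + X l) * (X k + st (X l))

/-- `r̄_{k,l} = (λ_k* + λ_l)(λ_k* + λ_l*)`. -/
def brg (k l : Fin 2 ⊕ Fin 2) : P := (st (X k) + X l) * (st (X k) + st (X l))

/-- `h₂₁ = λ₂₁²(λ₂₁ - λ₂₁*) σ₂₁⁻¹(λ₂₁ - λ₂₁*)`. -/
def h21 : P := X i21 ^ 2 * (X i21 - st (X i21)) * (shift i21).symm (X i21 - st (X i21))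

/-- The fraction `f / g ∈ L`, for `g ∈ S`. -/
def ratio (f g : P) : base.L := algebraMap P base.L f * Ring.inverse (algebraMap P base.L g)

/-- `μ^{xx}_{k,l} = -r_{l,k} / r_{k,l}`, for `{k, l} = {11, 21}`. -/
def μxx (k l : Fin 2) : base.L :=
  -ratio (rg (Sum.inl l) (Sum.inl k)) (rg (Sum.inl k) (Sum.inl l))

/-- `μ^{xy}_{k,l} = -r̄_{l,k} / r_{k,l}`, for `{k, l} = {11, 21}`. -/
def μxy (k l : Fin 2) : base.L :=
  -ratio (brg (Sum.inl l) (Sum.inl k)) (rg (Sum.inl k) (Sum.inl l))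

/-- `μ^{yx}_{k,l} = -r_{l,k} / r̄_{k,l}`, for `{k, l} = {11, 21}`. -/
def μyx (k l : Fin 2) : base.L :=
  -ratio (rg (Sum.inl l) (Sum.inl k)) (brg (Sum.inl k) (Sum.inl l))

/-- `μ^{yy}_{k,l} = -r̄_{l,k} / r̄_{k,l}`, for `{k, l} = {11, 21}`. -/
def μyy (k l : Fin 2) : base.L :=
  -ratio (brg (Sum.inl l) (Sum.inl k)) (brg (Sum.inl k) (Sum.inl l))

/-- `t₁₁ = r_{11,21} / 4` and `t₂₁ = r_{21,11} r_{21,31} r_{21,32} / h₂₁`. -/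
def t : Fin 2 → base.L :=
  ![algebraMap P base.L (C (1 / 4) * rg i11 i21),
    ratio (rg i21 i11 * rg i21 i31 * rg i21 i32) h21]

/-- The matrix `(μ^{xx}_{k,l})`, with ones on the diagonal. -/
def μ (k l : Fin 2) : base.L := if k = l then 1 else μxx k l

lemma isUnit_S {g : P} (hg : g ∈ S) : IsUnit (algebraMap P base.L g) :=
  IsLocalization.map_units base.L (⟨g, hg⟩ : base.S)

lemma ratio_one (f : P) : algebraMap P base.L f = ratio f 1 := by simp [ratio]

lemma ratio_mul (f g f' g' : P) : ratio f g * ratio f' g' = ratio (f * f') (g * g') := by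
  simp only [ratio, map_mul, Ring.mul_inverse_rev]
  ring

lemma neg_ratio (f g : P) : -ratio f g = ratio (-f) g := by
  simp only [ratio, map_neg]
  ring

lemma ratio_congr {f g f' g' : P} (hg : g ∈ S) (hg' : g' ∈ S) (h : f * g' = f' * g) :
    ratio f g = ratio f' g' := by
  have h1 := Ring.inverse_mul_cancel _ (isUnit_S hg)
  have h2 := Ring.inverse_mul_cancel _ (isUnit_S hg')
  have h3 := congrArg (algebraMap P base.L) h
  rw [map_mul, map_mul] at h3
  simp only [ratio]
  linear_combination (Ring.inverse (algebraMap P base.L g)) *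
    (Ring.inverse (algebraMap P base.L g')) * h3
    - algebraMap P base.L f * Ring.inverse (algebraMap P base.L g) * h2
    + algebraMap P base.L f' * Ring.inverse (algebraMap P base.L g') * h1

lemma map_ratio (φ : base.L ≃+* base.L) (ψ : RingAut P) (hψ : ψ ∈ H)
    (h : ∀ f, φ (algebraMap P base.L f) = algebraMap P base.L (ψ f)) {f g : P} (hg : g ∈ S) :
    φ (ratio f g) = ratio (ψ f) (ψ g) := by
  have h1 := congrArg φ (Ring.mul_inverse_cancel _ (isUnit_S hg))
  rw [map_mul, h, map_one] at h1
  have h2 := Ring.inverse_mul_cancel _ (isUnit_S (apply_mem_S ψ hψ hg))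
  simp only [ratio, map_mul, h]
  linear_combination (algebraMap P base.L (ψ f)) *
      (Ring.inverse (algebraMap P base.L (ψ g))) * h1
    - (algebraMap P base.L (ψ f)) * φ (Ring.inverse (algebraMap P base.L g)) * h2

lemma σ_ratio (i : Fin 2) {f g : P} (hg : g ∈ S) :
    base.σ i (ratio f g) = ratio (shift (Sum.inl i) f) (shift (Sum.inl i) g) :=
  map_ratio _ _ (shift_mem_H i) (base.σ_algebraMap i) hg

lemma σ_symm_ratio (i : Fin 2) {f g : P} (hg : g ∈ S) :
    (base.σ i).symm (ratio f g) =
      ratio ((shift (Sum.inl i)).symm f) ((shift (Sum.inl i)).symm g) := by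
  have hg' : (shift (Sum.inl i)).symm g ∈ S := apply_mem_S _ (H.inv_mem (shift_mem_H i)) hg
  rw [RingEquiv.symm_apply_eq, σ_ratio i hg', RingEquiv.apply_symm_apply,
    RingEquiv.apply_symm_apply]

lemma inv_ratio {f g : P} (hg : g ∈ S) : base.inv (ratio f g) = ratio (st f) (st g) :=
  map_ratio _ _ st_mem_H base.inv_algebraMap hg

lemma perm_ratio (e : blockGroup 2 base.storey) {f g : P} (hg : g ∈ S) :
    base.perm e (ratio f g) = ratio (permute e.1 f) (permute e.1 g) :=
  map_ratio _ _ (permute_mem_H e.2) (base.perm_algebraMap e) hg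

lemma shift_mem (i : Fin 2) {g : P} (hg : g ∈ S) : shift (Sum.inl i) g ∈ S :=
  apply_mem_S _ (shift_mem_H i) hg

lemma shift_symm_mem (i : Fin 2) {g : P} (hg : g ∈ S) : (shift (Sum.inl i)).symm g ∈ S :=
  apply_mem_S _ (H.inv_mem (shift_mem_H i)) hg

lemma st_mem {g : P} (hg : g ∈ S) : st g ∈ S := apply_mem_S _ st_mem_H hg

lemma st_X11 : st (X i11) = -X i11 := by simp [st, Base.star_X, ζ]

lemma st_X21 : st (X i21) = 1 - X i21 := by simp [st, Base.star_X, ζ]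

lemma st_X31 : st (X i31) = -X i31 := by simp [st, Base.star_X, ζ]

lemma st_X32 : st (X i32) = -X i32 := by simp [st, Base.star_X, ζ]

lemma neg_mem_S {f : P} (hf : f ∈ S) : -f ∈ S := by
  rw [← neg_one_mul]
  exact S.mul_mem base.neg_one_mem hf

lemma add_mem_S (k : Fin 2 ⊕ Fin 2) (hk : k ∈ ({i11, i31, i32} : Set (Fin 2 ⊕ Fin 2))) :
    (X i21 + X k : P) ∈ S := mem_S_of_Ω (Or.inr ⟨k, hk, Or.inl rfl⟩)

lemma sub_mem_S (k : Fin 2 ⊕ Fin 2) (hk : k ∈ ({i11, i31, i32} : Set (Fin 2 ⊕ Fin 2))) :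
    (X i21 - X k : P) ∈ S := mem_S_of_Ω (Or.inr ⟨k, hk, Or.inr rfl⟩)

lemma X21_mem_S : (X i21 : P) ∈ S := mem_S_of_Ω (Or.inl (by simp))

lemma rg_mem_S (k : Fin 2 ⊕ Fin 2) (hk : k ∈ ({i11, i31, i32} : Set (Fin 2 ⊕ Fin 2))) :
    rg i21 k ∈ S := by
  refine S.mul_mem (add_mem_S k hk) ?_
  have h : st (X k) = -X k := by
    rcases hk with rfl | rfl | rfl
    · exact st_X11
    · exact st_X31
    · exact st_X32
  rw [h, ← sub_eq_add_neg]
  exact sub_mem_S k hk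

lemma rg_mem_S' : rg i11 i21 ∈ S := by
  refine S.mul_mem ?_ ?_
  · rw [add_comm]; exact add_mem_S i11 (by simp)
  · have h := neg_mem_S (shift_mem 1 (sub_mem_S i11 (by simp)))
    rw [map_sub, Base.shift_X, Base.shift_X] at h
    simp only [if_true, Sum.inl.injEq, zero_ne_one, if_false] at h
    rw [st_X21]
    convert h using 1
    ring

lemma rg_mem {i j : Fin 2} (h : i ≠ j) : rg (Sum.inl i) (Sum.inl j) ∈ S := by
  fin_cases i <;> fin_cases j
  · exact absurd rfl h
  · exact rg_mem_S'
  · exact rg_mem_S i11 (by simp)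
  · exact absurd rfl h

lemma two_X21_mem_S : (X i21 - st (X i21) : P) ∈ S := by
  have h : (X i21 - st (X i21) : P) = 2 * X i21 - 1 := by rw [st_X21]; ring
  rw [h]
  exact mem_S_of_Ω (Or.inl (by simp))

lemma h21_mem_S : h21 ∈ S :=
  S.mul_mem (S.mul_mem (S.pow_mem X21_mem_S 2) two_X21_mem_S) (shift_symm_mem 1 two_X21_mem_S)

lemma brg_eq (k l : Fin 2 ⊕ Fin 2) : brg k l = st (rg k l) := by
  have h : st (st (X l)) = (X l : P) := by simp [st, Base.star_X]
  rw [brg, rg, map_mul, map_add, map_add, h, mul_comm]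

lemma quarter (f : P) : (C (1 / 4) * f : P) * 4 = f := by
  have h : (C (1 / 4) * 4 : P) = 1 := by
    have h4 : (4 : P) = C 4 := by simpa using (C_eq_coe_nat (σ := Fin 2 ⊕ Fin 2) (R := ℂ) 4).symm
    rw [h4, ← C_mul]
    norm_num
  linear_combination f * h

lemma st_quarter : st (C (1 / 4) : P) = C (1 / 4) := by
  rw [st, Base.star_C]
  congr 1
  rw [map_div₀, map_one, map_ofNat]

lemma perm_fst (e : blockGroup 2 base.storey) (i : Fin 2) : e.1.1 i = i := by
  have h : Function.Injective storey := by
    intro i j h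
    fin_cases i <;> fin_cases j <;> simp [storey] at h ⊢
  exact h (e.2 i)

lemma permute_inl (e : blockGroup 2 base.storey) (i : Fin 2) :
    permute e.1 (X (Sum.inl i) : P) = X (Sum.inl i) := by
  rw [Base.permute_X]
  congr 1
  simp [perm_fst]

lemma permute_st (e : blockGroup 2 base.storey) (k : Fin 2 ⊕ Fin 2) :
    permute e.1 (st (X k)) = st (permute e.1 (X k)) := by
  have := base.ζ_perm e k
  change ζ _ = ζ _ at this
  rw [st, Base.permute_X, Base.star_X, Base.star_X, this, map_sub, map_natCast, Base.permute_X]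

lemma permute_rg (e : blockGroup 2 base.storey) (k l : Fin 2 ⊕ Fin 2) :
    permute e.1 (rg k l) =
      rg (Equiv.sumCongr e.1.1 e.1.2 k) (Equiv.sumCongr e.1.1 e.1.2 l) := by
  simp only [rg, map_mul, map_add, permute_st, Base.permute_X]

lemma permute_rg_prod (e : blockGroup 2 base.storey) :
    permute e.1 (rg i21 i11 * rg i21 i31 * rg i21 i32) = rg i21 i11 * rg i21 i31 * rg i21 i32 := by
  have h : ∏ j : Fin 2, rg i21 (Sum.inr (e.1.2 j)) = ∏ j : Fin 2, rg i21 (Sum.inr j) :=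
    Equiv.prod_comp e.1.2 (fun j => rg i21 (Sum.inr j))
  rw [Fin.prod_univ_two, Fin.prod_univ_two] at h
  simp only [map_mul, permute_rg, Equiv.sumCongr_apply, Sum.map_inl, Sum.map_inr, perm_fst]
  rw [mul_assoc, h, mul_assoc]

lemma permute_shift_symm (e : blockGroup 2 base.storey) (f : P) :
    permute e.1 ((shift i21).symm f) = (shift i21).symm (permute e.1 f) := by
  have : ((permute e.1 : P ≃+* P).toRingHom.comp (shift i21).symm.toRingHom : P →+* P) =
      (shift i21).symm.toRingHom.comp (permute e.1).toRingHom := by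
    apply MvPolynomial.ringHom_ext
    · intro c
      have h : (shift i21).symm (C c : P) = C c := by
        rw [RingEquiv.symm_apply_eq, Base.shift_C]
      simp [h, Base.permute_C]
    · rintro (i | i)
      · simp only [RingEquiv.toRingHom_eq_coe, RingHom.comp_apply, RingHom.coe_coe,
          Base.shift_symm_X, permute_inl]
        split_ifs <;> simp [permute_inl]
      · simp [Base.shift_symm_X, Base.permute_X]
  exact congrArg (fun φ : P →+* P => φ f) this

lemma permute_h21 (e : blockGroup 2 base.storey) : permute e.1 h21 = h21 := by
  simp only [h21, map_mul, map_pow, permute_shift_symm, map_sub, permute_st, permute_inl]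

lemma μ_ne {k l : Fin 2} (h : k ≠ l) :
    μ k l = ratio (-rg (Sum.inl l) (Sum.inl k)) (rg (Sum.inl k) (Sum.inl l)) := by
  rw [μ, if_neg h, μxx, neg_ratio]

lemma t_zero : t 0 = ratio (C (1 / 4) * rg i11 i21) 1 := ratio_one _

lemma t_one : t 1 = ratio (rg i21 i11 * rg i21 i31 * rg i21 i32) h21 := rfl

lemma t_one_num_mem : rg i21 i11 * rg i21 i31 * rg i21 i32 ∈ S :=
  S.mul_mem (S.mul_mem (rg_mem_S i11 (by simp)) (rg_mem_S i31 (by simp))) (rg_mem_S i32 (by simp))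

lemma inv_t_zero : base.inv (t 0) = ratio (C (1 / 4) * st (rg i11 i21)) 1 := by
  rw [t_zero, inv_ratio S.one_mem, map_one, map_mul, st_quarter]

lemma inv_t_one :
    base.inv (t 1) = ratio (st (rg i21 i11 * rg i21 i31 * rg i21 i32)) (st h21) := by
  rw [t_one, inv_ratio h21_mem_S]

lemma shift_symm_C (i : Fin 2 ⊕ Fin 2) (c : ℂ) : (shift i).symm (C c : P) = C c := by
  rw [RingEquiv.symm_apply_eq, Base.shift_C]

lemma σ_σ_μ_aux {i j : Fin 2} (h : i ≠ j) : base.σ i (base.σ j (μ i j)) = μ i j := by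
  rw [μ_ne h, σ_ratio _ (rg_mem h), σ_ratio _ (shift_mem _ (rg_mem h))]
  refine ratio_congr (shift_mem _ (shift_mem _ (rg_mem h))) (rg_mem h) ?_
  fin_cases i <;> fin_cases j
  · exact absurd rfl h
  · simp [rg, st_X11, st_X21, Base.shift_X]
    ring
  · simp [rg, st_X11, st_X21, Base.shift_X]
    ring
  · exact absurd rfl h

lemma μ_mul_inv_aux {i j : Fin 2} (h : i ≠ j) : μ i j * base.inv (μ i j) = 1 := by
  rw [μ_ne h, inv_ratio (rg_mem h), ratio_mul, ← map_one (algebraMap P base.L), ratio_one]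
  refine ratio_congr (S.mul_mem (rg_mem h) (st_mem (rg_mem h))) S.one_mem ?_
  fin_cases i <;> fin_cases j
  · exact absurd rfl h
  · simp [rg, st_X11, st_X21]
    ring
  · simp [rg, st_X11, st_X21]
    ring
  · exact absurd rfl h

lemma inv_t_aux (i : Fin 2) : base.inv (t i) = base.σ i (t i) := by
  fin_cases i
  · change base.inv (t 0) = base.σ 0 (t 0)
    rw [inv_t_zero, t_zero, σ_ratio _ S.one_mem, map_one]
    congr 1
    simp [rg, st_X11, st_X21, Base.shift_X, Base.shift_C]
    ring
  · change base.inv (t 1) = base.σ 1 (t 1)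
    rw [inv_t_one, t_one, σ_ratio _ h21_mem_S]
    congr 1
    · simp [rg, st_X11, st_X21, st_X31, st_X32, Base.shift_X]
      ring
    · simp [h21, st_X21, Base.shift_X, Base.shift_symm_X]
      ring

lemma rel_one_aux (i j : Fin 2) :
    base.σ i (μ i j) * base.σ j (μ i j) * (base.inv (t i) * (base.σ i).symm (base.inv (t j))) =
      (base.σ j).symm (base.inv (t i)) * base.inv (t j) := by
  by_cases h : i = j
  · subst h
    simp [μ, mul_comm]
  rw [μ_ne h, σ_ratio _ (rg_mem h), σ_ratio _ (rg_mem h)]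
  have h2 := st_mem h21_mem_S
  fin_cases i <;> fin_cases j
  · exact absurd rfl h
  · change ratio _ _ * ratio _ _ * (base.inv (t 0) * (base.σ 0).symm (base.inv (t 1))) =
      (base.σ 1).symm (base.inv (t 0)) * base.inv (t 1)
    rw [inv_t_zero, inv_t_one, σ_symm_ratio _ h2, σ_symm_ratio _ S.one_mem, ratio_mul, ratio_mul,
      ratio_mul, ratio_mul]
    refine ratio_congr ?_ ?_ ?_
    · exact S.mul_mem (S.mul_mem (shift_mem _ (rg_mem h)) (shift_mem _ (rg_mem h)))
        (S.mul_mem S.one_mem (shift_symm_mem _ h2))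
    · exact S.mul_mem (shift_symm_mem _ S.one_mem) h2
    · simp [rg, h21, st_X11, st_X21, st_X31, st_X32, Base.shift_X, Base.shift_symm_X, shift_symm_C]
      ring
  · change ratio _ _ * ratio _ _ * (base.inv (t 1) * (base.σ 1).symm (base.inv (t 0))) =
      (base.σ 0).symm (base.inv (t 1)) * base.inv (t 0)
    rw [inv_t_zero, inv_t_one, σ_symm_ratio _ h2, σ_symm_ratio _ S.one_mem, ratio_mul, ratio_mul,
      ratio_mul, ratio_mul]
    refine ratio_congr ?_ ?_ ?_
    · exact S.mul_mem (S.mul_mem (shift_mem _ (rg_mem h)) (shift_mem _ (rg_mem h)))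
        (S.mul_mem h2 (shift_symm_mem _ S.one_mem))
    · exact S.mul_mem (shift_symm_mem _ h2) S.one_mem
    · simp [rg, h21, st_X11, st_X21, st_X31, st_X32, Base.shift_X, Base.shift_symm_X, shift_symm_C]
      ring
  · exact absurd rfl h

lemma rel_two_aux (i j : Fin 2) :
    base.σ i (μ i j) * (base.σ j).symm (μ i j) * (base.inv (t i) * t j) =
      (base.σ j).symm (base.inv (t i)) * base.σ i (t j) := by
  by_cases h : i = j
  · subst h
    simp only [μ, if_true, map_one, one_mul]
    rw [inv_t_aux, RingEquiv.symm_apply_apply, mul_comm]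
  rw [μ_ne h, σ_ratio _ (rg_mem h), σ_symm_ratio _ (rg_mem h)]
  have h1 := h21_mem_S
  have h2 := st_mem h21_mem_S
  fin_cases i <;> fin_cases j
  · exact absurd rfl h
  · change ratio _ _ * ratio _ _ * (base.inv (t 0) * t 1) =
      (base.σ 1).symm (base.inv (t 0)) * base.σ 0 (t 1)
    rw [inv_t_zero, t_one, σ_ratio _ h1, σ_symm_ratio _ S.one_mem, ratio_mul, ratio_mul,
      ratio_mul, ratio_mul]
    refine ratio_congr ?_ ?_ ?_
    · exact S.mul_mem (S.mul_mem (shift_mem _ (rg_mem h)) (shift_symm_mem _ (rg_mem h)))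
        (S.mul_mem S.one_mem h1)
    · exact S.mul_mem (shift_symm_mem _ S.one_mem) (shift_mem _ h1)
    · simp [rg, h21, st_X11, st_X21, st_X31, st_X32, Base.shift_X, Base.shift_symm_X, shift_symm_C]
      ring
  · change ratio _ _ * ratio _ _ * (base.inv (t 1) * t 0) =
      (base.σ 0).symm (base.inv (t 1)) * base.σ 1 (t 0)
    rw [inv_t_one, t_zero, σ_ratio _ S.one_mem, σ_symm_ratio _ h2, ratio_mul, ratio_mul,
      ratio_mul, ratio_mul]
    refine ratio_congr ?_ ?_ ?_
    · exact S.mul_mem (S.mul_mem (shift_mem _ (rg_mem h)) (shift_symm_mem _ (rg_mem h)))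
        (S.mul_mem h2 S.one_mem)
    · exact S.mul_mem (shift_symm_mem _ h2) (shift_mem _ S.one_mem)
    · simp [rg, h21, st_X11, st_X21, st_X31, st_X32, Base.shift_X, Base.shift_symm_X, Base.shift_C]
      ring
  · exact absurd rfl h

lemma no_three {i j k : Fin 2} (h : i ≠ j) (h1 : k ≠ i) (h2 : k ≠ j) : False := by omega

/-- The RTGW datum of the orthogonal algebra of rank three. -/
def datum : Datum 2 2 where
  toBase := base
  t := t
  μ := μ
  isUnit_t := by
    intro i
    fin_cases i
    · change IsUnit (algebraMap P base.L (C (1 / 4) * rg i11 i21))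
      rw [map_mul]
      refine IsUnit.mul (IsUnit.map _ (IsUnit.map C ?_)) (isUnit_S rg_mem_S')
      exact IsUnit.mk0 _ (by norm_num)
    · exact (isUnit_S t_one_num_mem).mul (isUnit_S h21_mem_S).ringInverse
  inv_t := inv_t_aux
  μ_mul := by
    intro i j
    by_cases h : i = j
    · subst h; simp [μ]
    · rw [μ_ne h, μ_ne (Ne.symm h), ratio_mul, ← map_one (algebraMap P base.L), ratio_one]
      refine ratio_congr (S.mul_mem (rg_mem h) (rg_mem (Ne.symm h))) S.one_mem ?_
      ring
  μ_self := by intro i; simp [μ]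
  perm_t := by
    intro e i
    have he := perm_fst e i
    rw [he]
    fin_cases i
    · change base.perm e (t 0) = t 0
      rw [t_zero, perm_ratio e S.one_mem, map_one, map_mul, permute_rg, Base.permute_C]
      simp [perm_fst]
    · change base.perm e (t 1) = t 1
      rw [t_one, perm_ratio e h21_mem_S, permute_h21, permute_rg_prod]
  perm_μ := by
    intro e i j
    have hi := perm_fst e i
    have hj := perm_fst e j
    rw [hi, hj]
    by_cases h : i = j
    · subst h; simp [μ]
    · rw [μ_ne h, perm_ratio e (rg_mem h), map_neg, permute_rg, permute_rg]
      simp [perm_fst]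
  μ_mul_inv := by
    intro i j
    by_cases h : i = j
    · subst h; simp [μ]
    · exact μ_mul_inv_aux h
  σ_σ_μ := by
    intro i j
    by_cases h : i = j
    · subst h; simp [μ]
    · exact σ_σ_μ_aux h
  σ_μ := by
    intro i j k h1 h2
    have h : i = j := by omega
    subst h
    simp [μ]
  σ_μ_mul_σ_μ := rel_one_aux
  σ_μ_mul_σ_symm_μ := rel_two_aux
  σ_t_mul_σ_t := fun _ _ _ h h1 h2 => (no_three h h1 h2).elim
  σ_t_mul_σ_symm_t := fun _ _ _ h h1 h2 => (no_three h h1 h2).elim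

/-- The RTGW algebra of the orthogonal algebra of rank three. -/
abbrev 𝔄 : Type := Alg datum

/-- The coefficient homomorphism `L → 𝔄`. -/
abbrev co : base.L →+* 𝔄 := Alg.coef datum

/-- `x₁₁`. -/
abbrev x11 : 𝔄 := Alg.x datum 0

/-- `y₁₁`. -/
abbrev y11 : 𝔄 := Alg.y datum 0

/-- `x₂₁`. -/
abbrev x21 : 𝔄 := Alg.x datum 1

/-- `y₂₁`. -/
abbrev y21 : 𝔄 := Alg.y datum 1

/-- `λ₁₁⁻¹C = -i λ₃₁λ₃₂ / (λ₂₁(1 - λ₂₁))`. -/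
def C' : base.L := ratio (-(C Complex.I * X i31 * X i32)) (X i21 * (1 - X i21))

/-- `C = -i λ₁₁λ₃₁λ₃₂ / (λ₂₁(1 - λ₂₁))`. -/
def CC : base.L := ratio (-(C Complex.I * X i11 * X i31 * X i32)) (X i21 * (1 - X i21))

/-- The element `U₁`. -/
def U₁ : 𝔄 := x11 + y11

/-- The element `U₂`. -/
def U₂ : 𝔄 := x21 + y21 + co CC

/-- The element `U₃`. -/
def U₃ : 𝔄 :=
  co (1 - μxx 1 0) * x11 * x21 + co (1 - μyx 1 0) * x11 * y21 + co (1 - μxy 1 0) * y11 * x21 +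
    co (1 - μyy 1 0) * y11 * y21 - co C' * (x11 - y11)

/-- The Lie subalgebra `𝔤_so(3;ℂ)` of `𝔄` generated by `U₁, U₂, U₃`. -/
def 𝔤 : LieSubalgebra ℂ 𝔄 := LieSubalgebra.lieSpan ℂ 𝔄 {U₁, U₂, U₃}

/-- `so(3;ℂ)`: the skew-symmetric complex `3 × 3` matrices. -/
abbrev so3 : LieSubalgebra ℂ (Matrix (Fin 3) (Fin 3) ℂ) := LieAlgebra.Orthogonal.so (Fin 3) ℂ

/-- `L_x = E₃₂ - E₂₃`. -/
def Lx : so3 := ⟨!![0, 0, 0; 0, 0, -1; 0, 1, 0], by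
  rw [LieAlgebra.Orthogonal.mem_so]
  ext i j
  fin_cases i <;> fin_cases j <;> simp⟩

/-- `L_y = E₁₃ - E₃₁`. -/
def Ly : so3 := ⟨!![0, 0, 1; 0, 0, 0; -1, 0, 0], by
  rw [LieAlgebra.Orthogonal.mem_so]
  ext i j
  fin_cases i <;> fin_cases j <;> simp⟩

/-- `L_z = E₂₁ - E₁₂`. -/
def Lz : so3 := ⟨!![0, -1, 0; 1, 0, 0; 0, 0, 0], by
  rw [LieAlgebra.Orthogonal.mem_so]
  ext i j
  fin_cases i <;> fin_cases j <;> simp⟩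

end So3

end RTGW

end

noncomputable section

namespace RTGW

section OrderedMonomials

variable {R A : Type*} [CommRing R] [Ring A] [Algebra R A]

/-- The ordered monomials `x ^ a * y ^ b * z ^ c`. -/
def orderedMonomial (x y z : A) (k : ℕ × ℕ × ℕ) : A := x ^ k.1 * y ^ k.2.1 * z ^ k.2.2

/-- The span of the ordered monomials of degree at most `n`. -/
def orderedSpan (R : Type*) {A : Type*} [CommRing R] [Ring A] [Algebra R A] (x y z : A) (n : ℕ) :
    Submodule R A :=
  Submodule.span R {m | ∃ a b c : ℕ, a + b + c ≤ n ∧ m = x ^ a * y ^ b * z ^ c}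

variable {x y z : A}

lemma orderedSpan_mono {n k : ℕ} (h : n ≤ k) : orderedSpan R x y z n ≤ orderedSpan R x y z k := by
  refine Submodule.span_mono ?_
  rintro m ⟨a, b, c, hn, rfl⟩
  exact ⟨a, b, c, hn.trans h, rfl⟩

lemma mem_orderedSpan (a b c n : ℕ) (h : a + b + c ≤ n) :
    x ^ a * y ^ b * z ^ c ∈ orderedSpan R x y z n :=
  Submodule.subset_span ⟨a, b, c, h, rfl⟩

lemma mul_mem_orderedSpan_of {g : A} {n k : ℕ}
    (h : ∀ a b c : ℕ, a + b + c ≤ n → g * (x ^ a * y ^ b * z ^ c) ∈ orderedSpan R x y z k) :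
    ∀ u ∈ orderedSpan R x y z n, g * u ∈ orderedSpan R x y z k := by
  intro u hu
  have : orderedSpan R x y z n ≤ (orderedSpan R x y z k).comap (LinearMap.mulLeft R g) := by
    refine Submodule.span_le.mpr ?_
    rintro m ⟨a, b, c, hn, rfl⟩
    exact h a b c hn
  exact this hu

lemma x_mul_mem_orderedSpan (n : ℕ) :
    ∀ u ∈ orderedSpan R x y z n, x * u ∈ orderedSpan R x y z (n + 1) := by
  refine mul_mem_orderedSpan_of fun a b c h => ?_
  have : x * (x ^ a * y ^ b * z ^ c) = x ^ (a + 1) * y ^ b * z ^ c := by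
    simp only [pow_succ', mul_assoc]
  rw [this]
  exact mem_orderedSpan _ _ _ _ (by omega)

lemma y_z_mul_mem_orderedSpan (hyx : y * x = x * y - z) (hzx : z * x = x * z + y)
    (hzy : z * y = y * z - x) (n : ℕ) :
    (∀ u ∈ orderedSpan R x y z n, y * u ∈ orderedSpan R x y z (n + 1)) ∧
      ∀ u ∈ orderedSpan R x y z n, z * u ∈ orderedSpan R x y z (n + 1) := by
  induction n with
  | zero =>
    constructor <;> refine mul_mem_orderedSpan_of fun a b c h => ?_
    · obtain ⟨rfl, rfl, rfl⟩ : a = 0 ∧ b = 0 ∧ c = 0 := by omega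
      simpa using mem_orderedSpan (R := R) (x := x) (y := y) (z := z) 0 1 0 1 le_rfl
    · obtain ⟨rfl, rfl, rfl⟩ : a = 0 ∧ b = 0 ∧ c = 0 := by omega
      simpa using mem_orderedSpan (R := R) (x := x) (y := y) (z := z) 0 0 1 1 le_rfl
  | succ n ih =>
    obtain ⟨hy, hz⟩ := ih
    have hy' : ∀ u ∈ orderedSpan R x y z (n + 1), y * u ∈ orderedSpan R x y z (n + 1 + 1) := by
      refine mul_mem_orderedSpan_of fun a b c h => ?_
      rcases a with _ | a
      · have : y * (x ^ 0 * y ^ b * z ^ c) = x ^ 0 * y ^ (b + 1) * z ^ c := by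
          simp only [pow_succ', mul_assoc, pow_zero, one_mul]
        rw [this]
        exact mem_orderedSpan _ _ _ _ (by omega)
      · have hm : x ^ a * y ^ b * z ^ c ∈ orderedSpan R x y z n := mem_orderedSpan _ _ _ _ (by omega)
        have : y * (x ^ (a + 1) * y ^ b * z ^ c) =
            x * (y * (x ^ a * y ^ b * z ^ c)) - z * (x ^ a * y ^ b * z ^ c) := by
          simp only [pow_succ', ← mul_assoc, hyx]
          noncomm_ring
        rw [this]
        exact sub_mem (x_mul_mem_orderedSpan _ _ (hy _ hm)) (orderedSpan_mono (by omega) (hz _ hm))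
    refine ⟨hy', mul_mem_orderedSpan_of fun a b c h => ?_⟩
    rcases a with _ | a
    · rcases b with _ | b
      · have : z * (x ^ 0 * y ^ 0 * z ^ c) = x ^ 0 * y ^ 0 * z ^ (c + 1) := by
          simp only [pow_succ', pow_zero, one_mul]
        rw [this]
        exact mem_orderedSpan _ _ _ _ (by omega)
      · have hm : x ^ 0 * y ^ b * z ^ c ∈ orderedSpan R x y z n := mem_orderedSpan _ _ _ _ (by omega)
        have : z * (x ^ 0 * y ^ (b + 1) * z ^ c) =
            y * (z * (x ^ 0 * y ^ b * z ^ c)) - x * (x ^ 0 * y ^ b * z ^ c) := by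
          simp only [pow_succ', pow_zero, one_mul, ← mul_assoc, hzy]
          noncomm_ring
        rw [this]
        exact sub_mem (hy' _ (hz _ hm)) (orderedSpan_mono (by omega) (x_mul_mem_orderedSpan _ _ hm))
    · have hm : x ^ a * y ^ b * z ^ c ∈ orderedSpan R x y z n := mem_orderedSpan _ _ _ _ (by omega)
      have : z * (x ^ (a + 1) * y ^ b * z ^ c) =
          x * (z * (x ^ a * y ^ b * z ^ c)) + y * (x ^ a * y ^ b * z ^ c) := by
        simp only [pow_succ', ← mul_assoc, hzx]
        noncomm_ring
      rw [this]
      exact add_mem (x_mul_mem_orderedSpan _ _ (hz _ hm)) (orderedSpan_mono (by omega) (hy _ hm))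

/-- If `x, y, z` satisfy the commutation relations of `so(3)`, the ordered monomials span the
algebra generated by them. -/
lemma adjoin_le_span_orderedMonomial (hyx : y * x = x * y - z) (hzx : z * x = x * z + y)
    (hzy : z * y = y * z - x) :
    (Algebra.adjoin R {x, y, z}).toSubmodule ≤
      Submodule.span R (Set.range (orderedMonomial x y z)) := by
  have hle : ∀ n, orderedSpan R x y z n ≤ Submodule.span R (Set.range (orderedMonomial x y z)) := by
    intro n
    refine Submodule.span_mono ?_
    rintro m ⟨a, b, c, -, rfl⟩
    exact ⟨(a, b, c), rfl⟩
  intro u hu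
  suffices h : ∃ n, u ∈ orderedSpan R x y z n from hle _ h.choose_spec
  have key : ∀ v, (∃ n, v ∈ orderedSpan R x y z n) → ∃ n, u * v ∈ orderedSpan R x y z n := by
    induction hu using Algebra.adjoin_induction with
    | mem g hg =>
      rintro v ⟨n, hv⟩
      refine ⟨n + 1, ?_⟩
      have h2 := y_z_mul_mem_orderedSpan (R := R) hyx hzx hzy n
      rcases hg with rfl | rfl | rfl
      · exact x_mul_mem_orderedSpan _ _ hv
      · exact h2.1 _ hv
      · exact h2.2 _ hv
    | algebraMap r =>
      rintro v ⟨n, hv⟩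
      refine ⟨n, ?_⟩
      rw [← Algebra.smul_def]
      exact Submodule.smul_mem _ _ hv
    | add f g _ _ hf hg =>
      intro v hv
      obtain ⟨n, hn⟩ := hf v hv
      obtain ⟨k, hk⟩ := hg v hv
      refine ⟨max n k, ?_⟩
      rw [add_mul]
      exact add_mem (orderedSpan_mono (le_max_left _ _) hn) (orderedSpan_mono (le_max_right _ _) hk)
    | mul f g _ _ hf hg =>
      intro v hv
      rw [mul_assoc]
      exact hf _ (hg v hv)
  have h := key 1 ⟨0, by simpa using mem_orderedSpan (R := R) (x := x) (y := y) (z := z) 0 0 0 0 le_rfl⟩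
  rwa [mul_one] at h

lemma map_orderedMonomial {B F : Type*} [Ring B] [FunLike F A B] [RingHomClass F A B]
    (f : F) (k : ℕ × ℕ × ℕ) :
    f (orderedMonomial x y z k) = orderedMonomial (f x) (f y) (f z) k := by
  simp [orderedMonomial]

end OrderedMonomials

section HasTop

open LaurentPolynomial

variable {B : Type*} [Ring B]

/-- The Laurent polynomial `f` has degree at most `n`, and `b` is its coefficient of degree `n`. -/
def HasTop (f : B[T;T⁻¹]) (n : ℤ) (b : B) : Prop :=
  f.coeff n = b ∧ ∀ m, n < m → f.coeff m = 0

lemma HasTop.mul {f g : B[T;T⁻¹]} {n m : ℤ} {b c : B} (hf : HasTop f n b) (hg : HasTop g m c) :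
    HasTop (f * g) (n + m) (b * c) := by
  have key : ∀ k, n + m ≤ k → (f * g).coeff k = f.coeff n * g.coeff (-n + k) := by
    intro k hk
    rw [AddMonoidAlgebra.coeff_mul_apply_left, Finsupp.sum]
    refine Finset.sum_eq_single n ?_ ?_
    · intro h _ hne
      rcases lt_or_gt_of_ne hne with hlt | hlt
      · rw [hg.2 _ (by omega), mul_zero]
      · rw [hf.2 _ hlt, zero_mul]
    · intro h
      rw [Finsupp.notMem_support_iff.mp h, zero_mul]
  constructor
  · rw [key _ le_rfl, hf.1, neg_add_cancel_left, hg.1]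
  · intro k hk
    rw [key _ hk.le, hg.2 _ (by omega), mul_zero]

lemma hasTop_single (n : ℤ) (b : B) : HasTop (AddMonoidAlgebra.single n b : B[T;T⁻¹]) n b := by
  refine ⟨?_, fun m hm => ?_⟩
  · rw [AddMonoidAlgebra.coeff_single, Finsupp.single_eq_same]
  · rw [AddMonoidAlgebra.coeff_single, Finsupp.single_eq_of_ne hm.ne']

lemma hasTop_one : HasTop (1 : B[T;T⁻¹]) 0 1 := by
  rw [AddMonoidAlgebra.one_def]
  exact hasTop_single 0 1

lemma HasTop.pow {f : B[T;T⁻¹]} {n : ℤ} {b : B} (hf : HasTop f n b) (k : ℕ) :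
    HasTop (f ^ k) (k * n) (b ^ k) := by
  induction k with
  | zero => simpa using hasTop_one
  | succ k ih =>
    rw [pow_succ, pow_succ]
    convert ih.mul hf using 1
    push_cast
    ring

lemma HasTop.sub {f g : B[T;T⁻¹]} {n : ℤ} {b c : B} (hf : HasTop f n b) (hg : HasTop g n c) :
    HasTop (f - g) n (b - c) := by
  refine ⟨by simp [hf.1, hg.1], fun m hm => by simp [hf.2 m hm, hg.2 m hm]⟩

lemma HasTop.add_of_lt {f g : B[T;T⁻¹]} {n m : ℤ} {b c : B} (hf : HasTop f n b)
    (hg : HasTop g m c) (h : m < n) : HasTop (f + g) n b := by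
  refine ⟨by simp [hf.1, hg.2 n h], fun k hk => by simp [hf.2 k hk, hg.2 k (h.trans hk)]⟩

lemma linearIndependent_of_hasTop {k ι : Type*} [Field k] [Algebra k B] {v : ι → B[T;T⁻¹]}
    {w : ι → ℤ} {b : ι → B} (h : ∀ i, HasTop (v i) (w i) (b i)) (hb : LinearIndependent k b) :
    LinearIndependent k v := by
  classical
  rw [linearIndependent_iff']
  intro s g hg
  by_contra! hne
  obtain ⟨j, hj⟩ := hne
  obtain ⟨i, hi, hmax⟩ := (s.filter fun i => g i ≠ 0).exists_max_image w
    ⟨j, Finset.mem_filter.mpr hj⟩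
  rw [Finset.mem_filter] at hi
  have h0 := congrArg (fun f : B[T;T⁻¹] => f.coeff (w i)) hg
  simp only [AddMonoidAlgebra.coeff_sum, AddMonoidAlgebra.coeff_smul, Finsupp.coe_finsetSum,
    Finset.sum_apply, Finsupp.smul_apply, AddMonoidAlgebra.coeff_zero, Finsupp.coe_zero,
    Pi.zero_apply] at h0
  have h1 : ∑ l ∈ s.filter (fun l => w l = w i), g l • b l = 0 := by
    rw [Finset.sum_filter]
    refine Eq.trans (Finset.sum_congr rfl fun l hl => ?_) h0
    split_ifs with hw
    · rw [← hw, (h l).1]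
    · by_cases hgl : g l = 0
      · rw [hgl, zero_smul]
      · have := hmax l (Finset.mem_filter.mpr ⟨hl, hgl⟩)
        rw [(h l).2 _ (lt_of_le_of_ne this hw), smul_zero]
  exact hi.2 (linearIndependent_iff'.mp hb _ g h1 i (Finset.mem_filter.mpr ⟨hi.1, rfl⟩))

end HasTop

section Enveloping

open UniversalEnvelopingAlgebra

variable {k 𝔏 A : Type*} [Field k] [LieRing 𝔏] [LieAlgebra k 𝔏] [Ring A] [Algebra k A]

lemma adjoin_ι_eq_top {s : Set 𝔏} (hs : Submodule.span k s = ⊤) :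
    Algebra.adjoin k (ι k '' s) = (⊤ : Subalgebra k (UniversalEnvelopingAlgebra k 𝔏)) := by
  set N := Algebra.adjoin k (ι k '' s : Set (UniversalEnvelopingAlgebra k 𝔏))
  have hN : ∀ a : 𝔏, ι k a ∈ N := by
    intro a
    have ha : a ∈ Submodule.span k s := hs ▸ Submodule.mem_top
    have hle : Submodule.span k s ≤ N.toSubmodule.comap (ι k : 𝔏 →ₗ⁅k⁆ _).toLinearMap :=
      Submodule.span_le.mpr fun b hb => Algebra.subset_adjoin ⟨b, hb, rfl⟩
    exact hle ha
  let f : 𝔏 →ₗ⁅k⁆ N :=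
    { toFun := fun a => ⟨ι k a, hN a⟩
      map_add' := fun a b => Subtype.ext (map_add _ _ _)
      map_smul' := fun c a => Subtype.ext (map_smul _ _ _)
      map_lie' := fun {a b} => Subtype.ext (by
        simp only [LieHom.map_lie, LieRing.of_associative_ring_bracket]
        rfl) }
  have h : N.val.comp (lift k f) = AlgHom.id k _ := by
    ext a
    simp [f]
  rw [eq_top_iff]
  intro u _
  have hu := congrArg (fun φ : _ →ₐ[k] _ => φ u) h
  simp only [AlgHom.comp_apply, AlgHom.id_apply] at hu
  rw [← hu]
  exact (lift k f u).2

lemma lift_injective {f : 𝔏 →ₗ⁅k⁆ A} {x y z : 𝔏} (hs : Submodule.span k {x, y, z} = ⊤)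
    (hxy : ⁅x, y⁆ = z) (hzx : ⁅z, x⁆ = y) (hzy : ⁅z, y⁆ = -x)
    (hf : LinearIndependent k (orderedMonomial (f x) (f y) (f z))) :
    Function.Injective (lift k f) := by
  have htop := adjoin_ι_eq_top hs
  rw [Set.image_insert_eq, Set.image_pair] at htop
  have hspan := adjoin_le_span_orderedMonomial (R := k) (x := ι k x) (y := ι k y) (z := ι k z)
    (by rw [← hxy, LieHom.map_lie, LieRing.of_associative_ring_bracket]; abel)
    (by rw [← hzx, LieHom.map_lie, LieRing.of_associative_ring_bracket]; abel)
    (by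
      rw [← neg_neg x, ← hzy, map_neg, LieHom.map_lie, LieRing.of_associative_ring_bracket]; abel)
  rw [htop] at hspan
  rw [injective_iff_map_eq_zero]
  intro u hu
  have hu' := hspan (show u ∈ (⊤ : Subalgebra k _).toSubmodule from trivial)
  rw [Finsupp.mem_span_range_iff_exists_finsupp] at hu'
  obtain ⟨c, rfl⟩ := hu'
  have : c = 0 := by
    rw [linearIndependent_iff] at hf
    apply hf
    rw [Finsupp.linearCombination_apply, ← hu, map_finsuppSum]
    simp [map_orderedMonomial]
  rw [this, Finsupp.sum_zero_index]

end Enveloping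

section SkewLaurent

variable {L R : Type*} [CommRing L] [Ring R] [Module L R]

/-- Commutation relations in a skew Laurent polynomial ring in `X` and `Y` over `L`, `X'` and `Y'`
being the inverses of `X` and `Y`. -/
structure SkewLaurent (σ τ : L ≃+* L) (X X' Y Y' : R) : Prop where
  X_smul : ∀ (f : L) (r : R), X * (f • r) = σ f • (X * r)
  X'_smul : ∀ (f : L) (r : R), X' * (f • r) = σ.symm f • (X' * r)
  Y_smul : ∀ (f : L) (r : R), Y * (f • r) = τ f • (Y * r)
  Y'_smul : ∀ (f : L) (r : R), Y' * (f • r) = τ.symm f • (Y' * r)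
  X_X' : X * X' = 1
  X'_X : X' * X = 1
  Y_Y' : Y * Y' = 1
  Y'_Y : Y' * Y = 1
  Y_X : Y * X = X * Y

namespace SkewLaurent

variable {σ τ : L ≃+* L} {X X' Y Y' : R} (h : SkewLaurent σ τ X X' Y Y')

include h

lemma Y_X' : Y * X' = X' * Y := by
  calc Y * X' = X' * X * (Y * X') := by rw [h.X'_X, one_mul]
    _ = X' * (X * Y) * X' := by noncomm_ring
    _ = X' * Y * (X * X') := by rw [← h.Y_X]; noncomm_ring
    _ = X' * Y := by rw [h.X_X', mul_one]

lemma Y'_X : Y' * X = X * Y' := by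
  calc Y' * X = Y' * X * (Y * Y') := by rw [h.Y_Y', mul_one]
    _ = Y' * (X * Y) * Y' := by noncomm_ring
    _ = Y' * Y * X * Y' := by rw [← h.Y_X]; noncomm_ring
    _ = X * Y' := by rw [h.Y'_Y, one_mul]

lemma Y'_X' : Y' * X' = X' * Y' := by
  calc Y' * X' = Y' * X' * (Y * Y') := by rw [h.Y_Y', mul_one]
    _ = Y' * (X' * Y) * Y' := by noncomm_ring
    _ = Y' * Y * X' * Y' := by rw [← h.Y_X']; noncomm_ring
    _ = X' * Y' := by rw [h.Y'_Y, one_mul]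

end SkewLaurent

/-- Coefficients in `L` for which the elements `U₁ = (a - b) X + r (a + b) X⁻¹` and
`U₂ = Y + (b² - a²) q Y⁻¹ + aκ` satisfy the commutation relations of `so(3)`. -/
structure So3Coeff (σ τ : L ≃+* L) (a b r q κ : L) : Prop where
  r_four : 4 * r = 1
  σ_a : σ a = a - 1
  τ_a : τ a = a
  σ_b : σ b = b
  τ_b : τ b = b - 1
  σ_q : σ q = q
  σ_κ : σ κ = κ
  σ_τ : ∀ f, σ (τ f) = τ (σ f)
  q_eq : τ q * (2 * b - 3) - q * (2 * b + 1) + κ ^ 2 = -1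
  κ_eq : τ κ * (2 - b) = -(κ * b)

namespace So3Coeff

variable {σ τ : L ≃+* L} {X X' Y Y' : R} {a b r q κ : L}

variable [IsScalarTower L R R] (h : SkewLaurent σ τ X X' Y Y') (hc : So3Coeff σ τ a b r q κ)

include h hc

lemma commutators (U₁ U₂ U₃ : R) (h1 : U₁ = (a - b) • X + (r * (a + b)) • X')
    (h2 : U₂ = Y + ((b ^ 2 - a ^ 2) * q) • Y' + (a * κ) • (1 : R))
    (h3 : U₃ = -(X * Y) + r • (X' * Y) + ((a - b) * (a - b - 1) * q) • (X * Y')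
      - (r * (a + b) * (a + b + 1) * q) • (X' * Y') - κ • ((a - b) • X - (r * (a + b)) • X')) :
    U₁ * U₂ - U₂ * U₁ = U₃ ∧ U₃ * U₁ - U₁ * U₃ = U₂ ∧ U₃ * U₂ - U₂ * U₃ = -U₁ := by
  obtain ⟨hr, σa, τa, σb, τb, σq, σκ, στ, hq, hκ⟩ := hc
  have σa' : σ.symm a = a + 1 := by rw [RingEquiv.symm_apply_eq]; simp [σa]
  have τa' : τ.symm a = a := by rw [RingEquiv.symm_apply_eq]; simp [τa]
  have σb' : σ.symm b = b := by rw [RingEquiv.symm_apply_eq]; simp [σb]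
  have τb' : τ.symm b = b + 1 := by rw [RingEquiv.symm_apply_eq]; simp [τb]
  have σq' : σ.symm q = q := by rw [RingEquiv.symm_apply_eq]; simp [σq]
  have σκ' : σ.symm κ = κ := by rw [RingEquiv.symm_apply_eq]; simp [σκ]
  have στq : σ (τ q) = τ q := by rw [στ, σq]
  have στκ : σ (τ κ) = τ κ := by rw [στ, σκ]
  have στq' : σ (τ.symm q) = τ.symm q := by
    rw [RingEquiv.eq_symm_apply, ← στ, RingEquiv.apply_symm_apply, σq]
  have στκ' : σ (τ.symm κ) = τ.symm κ := by
    rw [RingEquiv.eq_symm_apply, ← στ, RingEquiv.apply_symm_apply, σκ]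
  have σ'τq : σ.symm (τ q) = τ q := by rw [RingEquiv.symm_apply_eq, στq]
  have σ'τκ : σ.symm (τ κ) = τ κ := by rw [RingEquiv.symm_apply_eq, στκ]
  have σ'τq' : σ.symm (τ.symm q) = τ.symm q := by rw [RingEquiv.symm_apply_eq, στq']
  have σ'τκ' : σ.symm (τ.symm κ) = τ.symm κ := by rw [RingEquiv.symm_apply_eq, στκ']
  have fixr : ∀ φ : L ≃+* L, φ r = r := by
    intro φ
    have h4 : 4 * φ r = 1 := by rw [← map_ofNat φ 4, ← map_mul, hr, map_one]
    linear_combination r * h4 - φ r * hr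
  have hq' := congrArg τ.symm hq
  have hκ' := congrArg τ.symm hκ
  simp only [map_add, map_sub, map_mul, map_pow, map_neg, map_one, map_ofNat, τb',
    RingEquiv.symm_apply_apply] at hq' hκ'
  have e1 : ∀ s, X * (X' * s) = s := fun s => by rw [← mul_assoc, h.X_X', one_mul]
  have e2 : ∀ s, X' * (X * s) = s := fun s => by rw [← mul_assoc, h.X'_X, one_mul]
  have e3 : ∀ s, Y * (X * s) = X * (Y * s) := fun s => by rw [← mul_assoc, h.Y_X, mul_assoc]
  have e4 : ∀ s, Y * (X' * s) = X' * (Y * s) := fun s => by rw [← mul_assoc, h.Y_X', mul_assoc]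
  have e5 : ∀ s, Y' * (X * s) = X * (Y' * s) := fun s => by rw [← mul_assoc, h.Y'_X, mul_assoc]
  have e6 : ∀ s, Y' * (X' * s) = X' * (Y' * s) := fun s => by rw [← mul_assoc, h.Y'_X', mul_assoc]
  subst h1 h2 h3
  refine ⟨?_, ?_, ?_⟩
  all_goals
    simp only [mul_add, add_mul, mul_sub, sub_mul, mul_neg, neg_mul, smul_mul_assoc,
      smul_sub, mul_one, one_mul, mul_assoc, h.X_smul, h.X'_smul, h.Y_smul, h.Y'_smul,
      h.X_X', h.X'_X, h.Y_Y', h.Y'_Y, h.Y_X, h.Y_X', h.Y'_X, h.Y'_X', e1, e2, e3, e4, e5, e6,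
      map_add, map_sub, map_mul, map_pow, map_one, σa, τa, σb, τb, σq, σκ, σa', τa', σb', τb', σq',
      σκ', στq, στκ, στq', στκ', σ'τq, σ'τκ, σ'τq', σ'τκ', fixr]
  · match_scalars <;> ring1
  · match_scalars
    all_goals first
      | ring1
      | linear_combination hr
      | linear_combination (b ^ 2 - a ^ 2) * q * hr
      | linear_combination a * κ * hr
  · match_scalars
    all_goals first
      | ring1
      | linear_combination (a - b) * hq
      | linear_combination r * (a + b) * hq
      | linear_combination hκ
      | linear_combination r * hκ
      | linear_combination (-(a - b) * (a - b - 1) * q) * hκ'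
      | linear_combination (-r * (a + b) * (a + b + 1) * q) * hκ'

end So3Coeff

end SkewLaurent

end RTGW

namespace RTGW
open MvPolynomial
namespace So3

lemma ratio_add {f g f' g' : P} (hg : g ∈ S) (hg' : g' ∈ S) :
    ratio f g + ratio f' g' = ratio (f * g' + f' * g) (g * g') := by
  have h1 := Ring.inverse_mul_cancel _ (isUnit_S hg)
  have h2 := Ring.inverse_mul_cancel _ (isUnit_S hg')
  simp only [ratio, map_mul, map_add, Ring.mul_inverse_rev]
  linear_combination (-(algebraMap P base.L f) * Ring.inverse (algebraMap P base.L g)) * h2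
    - algebraMap P base.L f' * Ring.inverse (algebraMap P base.L g') * h1

/-- `d = λ₁₁ - λ₂₁`. -/
def dd : P := X i11 - X i21

lemma dd_mem_S : dd ∈ S := by
  have h := neg_mem_S (sub_mem_S i11 (by simp))
  rwa [neg_sub] at h

lemma one_sub_X21_mem_S : (1 - X i21 : P) ∈ S := by
  rw [← st_X21]
  exact st_mem X21_mem_S

lemma C'_den_mem_S : (X i21 * (1 - X i21) : P) ∈ S := S.mul_mem X21_mem_S one_sub_X21_mem_S

lemma h21_eq : h21 = X i21 ^ 2 * (X i21 + X i21 - 1) * (X i21 + X i21 + 1) := by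
  simp only [h21, st_X21, map_sub, map_one, Base.shift_symm_X, if_true]
  ring

/-- The factor `q` of `t₂₁ = (λ₂₁² - λ₁₁²) q`. -/
def qq : base.L := ratio ((X i21 ^ 2 - X i31 ^ 2) * (X i21 ^ 2 - X i32 ^ 2)) h21

lemma t_one_eq : t 1 = (algebraMap P base.L (X i21) ^ 2 - algebraMap P base.L (X i11) ^ 2) * qq := by
  rw [t_one, qq, ← map_pow, ← map_pow, ← map_sub, ratio_one, ratio_mul, one_mul]
  congr 1
  simp only [rg, st_X11, st_X31, st_X32]
  ring

lemma CC_eq : CC = algebraMap P base.L (X i11) * C' := by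
  rw [CC, C', ratio_one, ratio_mul, one_mul]
  congr 1
  ring

lemma C_I_sq : (C Complex.I * C Complex.I : P) = -1 := by
  rw [← C_mul, Complex.I_mul_I, C_neg, C_1]

lemma h21_shift_mem : shift i21 h21 ∈ S := shift_mem 1 h21_mem_S

lemma So3Coeff_L : So3Coeff (base.σ 0) (base.σ 1) (algebraMap P base.L (X i11))
    (algebraMap P base.L (X i21)) (algebraMap P base.L (C (1 / 4))) qq C' where
  r_four := by
    have h := quarter 1
    rw [mul_one] at h
    rw [← map_ofNat (algebraMap P base.L) 4, ← map_mul, mul_comm, h, map_one]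
  σ_a := by simp [Base.σ_algebraMap, Base.shift_X]
  τ_a := by simp [Base.σ_algebraMap, Base.shift_X]
  σ_b := by simp [Base.σ_algebraMap, Base.shift_X]
  τ_b := by simp [Base.σ_algebraMap, Base.shift_X]
  σ_q := by
    rw [qq, σ_ratio _ h21_mem_S]
    simp [h21_eq, Base.shift_X]
  σ_κ := by
    rw [C', σ_ratio _ C'_den_mem_S]
    simp [Base.shift_X, Base.shift_C]
  σ_τ := by
    intro f
    have : (base.σ 0).toRingHom.comp (base.σ 1).toRingHom =
        (base.σ 1).toRingHom.comp (base.σ 0).toRingHom := by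
      apply base.hom_ext
      · intro c
        simp [Base.σ_algebraMap, Base.shift_C]
      · rintro (k | k)
        · fin_cases k <;> simp [Base.lam, Base.σ_algebraMap, Base.shift_X]
        · simp [Base.lam, Base.σ_algebraMap, Base.shift_X]
    exact congrArg (fun φ : base.L →+* base.L => φ f) this
  q_eq := by
    have h1 : 2 * algebraMap P base.L (X i21) - 3 = ratio (X i21 + X i21 - 1 - 1 - 1) 1 := by
      simp only [ratio, map_sub, map_add, map_one, Ring.inverse_one]
      ring
    have h2 : -(qq * (2 * algebraMap P base.L (X i21) + 1)) =
        qq * ratio (-(X i21 + X i21 + 1)) 1 := by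
      simp only [ratio, map_neg, map_add, map_one, Ring.inverse_one]
      ring
    have h3 : (-1 : base.L) = ratio (-1) 1 := by simp [ratio]
    rw [sub_eq_add_neg, h1, h2, h3, sq C', qq, C', σ_ratio _ h21_mem_S, ratio_mul, ratio_mul,
      ratio_mul, ratio_add (S.mul_mem h21_shift_mem S.one_mem) (S.mul_mem h21_mem_S S.one_mem),
      ratio_add (S.mul_mem (S.mul_mem h21_shift_mem S.one_mem) (S.mul_mem h21_mem_S S.one_mem))
        (S.mul_mem C'_den_mem_S C'_den_mem_S)]
    refine ratio_congr (S.mul_mem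
      (S.mul_mem (S.mul_mem h21_shift_mem S.one_mem) (S.mul_mem h21_mem_S S.one_mem))
        (S.mul_mem C'_den_mem_S C'_den_mem_S)) S.one_mem ?_
    have hI := C_I_sq
    simp [h21_eq, Base.shift_X]
    linear_combination (X i31 ^ 2 * X i32 ^ 2 * ((X i21 - 1) ^ 2 * (X i21 - 1 + (X i21 - 1) - 1) *
      (X i21 - 1 + (X i21 - 1) + 1)) * (X i21 ^ 2 * (X i21 + X i21 - 1) * (X i21 + X i21 + 1))) * hI
  κ_eq := by
    have h1 : 2 - algebraMap P base.L (X i21) = ratio (1 + 1 - X i21) 1 := by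
      simp only [ratio, map_sub, map_add, map_one, Ring.inverse_one]
      ring
    have h2 : -(C' * algebraMap P base.L (X i21)) = C' * ratio (-X i21) 1 := by
      simp only [ratio, map_neg, map_one, Ring.inverse_one]
      ring
    rw [h1, h2, C', σ_ratio _ C'_den_mem_S, ratio_mul, ratio_mul]
    refine ratio_congr (S.mul_mem (shift_mem 1 C'_den_mem_S) S.one_mem)
      (S.mul_mem C'_den_mem_S S.one_mem) ?_
    simp [Base.shift_X, Base.shift_C]
    ring

/-- The action of `L` on `𝔄` by left multiplication. -/
instance moduleL : Module base.L 𝔄 := Module.compHom 𝔄 co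

lemma smul_eq (f : base.L) (u : 𝔄) : f • u = co f * u := rfl

instance : IsScalarTower base.L 𝔄 𝔄 := ⟨fun f u v => mul_assoc (co f) u v⟩

lemma cross_t {k l : Fin 2} (h : k ≠ l) :
    (base.σ l).symm (base.σ k (base.σ l (t l))) = (base.σ l).symm (μ k l) * t l * μxy k l := by
  have h1 := h21_mem_S
  have h2 := rg_mem h
  have h3 : brg (Sum.inl l) (Sum.inl k) ∈ S := by
    rw [brg_eq]; exact st_mem (rg_mem h.symm)
  rw [μ_ne h, σ_symm_ratio _ h2, μxy, neg_ratio]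
  fin_cases k <;> fin_cases l
  · exact absurd rfl h
  · change (base.σ 1).symm (base.σ 0 (base.σ 1 (t 1))) = ratio _ _ * t 1 * ratio _ _
    rw [t_one, σ_ratio _ h1, σ_ratio _ (shift_mem _ h1), σ_symm_ratio _ (shift_mem _ (shift_mem _ h1)),
      ratio_mul, ratio_mul]
    refine ratio_congr (shift_symm_mem _ (shift_mem _ (shift_mem _ h1)))
      (S.mul_mem (S.mul_mem (shift_symm_mem _ h2) h1) h2) ?_
    simp [rg, brg, h21_eq, st_X11, st_X21, st_X31, st_X32, Base.shift_X, Base.shift_symm_X]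
    ring
  · change (base.σ 0).symm (base.σ 1 (base.σ 0 (t 0))) = ratio _ _ * t 0 * ratio _ _
    rw [t_zero, σ_ratio _ S.one_mem, σ_ratio _ (shift_mem _ S.one_mem),
      σ_symm_ratio _ (shift_mem _ (shift_mem _ S.one_mem)), ratio_mul, ratio_mul]
    refine ratio_congr (shift_symm_mem _ (shift_mem _ (shift_mem _ S.one_mem)))
      (S.mul_mem (S.mul_mem (shift_symm_mem _ h2) S.one_mem) h2) ?_
    simp [rg, brg, st_X11, st_X21, Base.shift_X, Base.shift_symm_X, Base.shift_C, shift_symm_C]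
    ring
  · exact absurd rfl h

lemma isUnit_μ (k l : Fin 2) : IsUnit (μ k l) := by
  exact IsUnit.of_mul_eq_one _ (datum.μ_mul k l)

lemma x_mul_x {k l : Fin 2} (h : k ≠ l) :
    Alg.x datum k * Alg.x datum l = co (μxx k l) * (Alg.x datum l * Alg.x datum k) := by
  have h1 := Alg.x_x datum k l
  have h2 : datum.μ k l = μxx k l := if_neg h
  rwa [h2] at h1

lemma y_mul_y {k l : Fin 2} (h : k ≠ l) :
    Alg.y datum k * Alg.y datum l = co (μyy k l) * (Alg.y datum l * Alg.y datum k) := by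
  have h1 := Alg.y_y datum k l
  have h2 : datum.inv (datum.μ k l) = μyy k l := by
    change base.inv (μ k l) = μyy k l
    rw [μ_ne h, inv_ratio (rg_mem h), map_neg, ← brg_eq, ← brg_eq, μyy, neg_ratio]
  rwa [h2] at h1

lemma x_mul_y {k l : Fin 2} (h : k ≠ l) :
    Alg.x datum k * Alg.y datum l = co (μxy k l) * (Alg.y datum l * Alg.x datum k) := by
  have hu : IsUnit (co ((base.σ l).symm (μ k l) * t l)) :=
    (((isUnit_μ k l).map _).mul (datum.isUnit_t l)).map co
  apply hu.mul_left_cancel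
  have e1 : Alg.y datum l * (Alg.x datum k * Alg.x datum l) * Alg.y datum l =
      co ((base.σ l).symm (base.σ k (base.σ l (t l)))) * (Alg.y datum l * Alg.x datum k) := by
    have hx : Alg.x datum l * Alg.y datum l = co (base.σ l (t l)) := Alg.x_y datum l
    have hxc : Alg.x datum k * co (base.σ l (t l)) =
      co (base.σ k (base.σ l (t l))) * Alg.x datum k := Alg.x_coef datum k _
    have hyc : Alg.y datum l * co (base.σ k (base.σ l (t l))) =
      co ((base.σ l).symm (base.σ k (base.σ l (t l)))) * Alg.y datum l := Alg.y_coef datum l _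
    calc _ = Alg.y datum l * (Alg.x datum k * (Alg.x datum l * Alg.y datum l)) := by noncomm_ring
      _ = Alg.y datum l * co (base.σ k (base.σ l (t l))) * Alg.x datum k := by
        rw [hx, hxc, mul_assoc]
      _ = _ := by rw [hyc, mul_assoc]
  have e2 : Alg.y datum l * (Alg.x datum k * Alg.x datum l) * Alg.y datum l =
      co ((base.σ l).symm (μ k l) * t l) * (Alg.x datum k * Alg.y datum l) := by
    have hxx : Alg.x datum k * Alg.x datum l = co (μ k l) * (Alg.x datum l * Alg.x datum k) :=
      Alg.x_x datum k l
    have hyc : Alg.y datum l * co (μ k l) = co ((base.σ l).symm (μ k l)) * Alg.y datum l :=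
      Alg.y_coef datum l _
    have hyx : Alg.y datum l * Alg.x datum l = co (t l) := Alg.y_x datum l
    calc _ = Alg.y datum l * co (μ k l) * (Alg.x datum l * (Alg.x datum k * Alg.y datum l)) := by
          rw [hxx]; noncomm_ring
      _ = co ((base.σ l).symm (μ k l)) * (Alg.y datum l * Alg.x datum l) *
          (Alg.x datum k * Alg.y datum l) := by rw [hyc]; noncomm_ring
      _ = _ := by rw [hyx, map_mul]
  rw [← e2, e1, cross_t h, map_mul _ _ (μxy k l), mul_assoc]

lemma y_mul_x {k l : Fin 2} (h : k ≠ l) :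
    Alg.y datum k * Alg.x datum l = co (μyx k l) * (Alg.x datum l * Alg.y datum k) := by
  have h1 := rg_mem h.symm
  have h2 : brg (Sum.inl k) (Sum.inl l) ∈ S := by rw [brg_eq]; exact st_mem (rg_mem h)
  have h3 : μyx k l * μxy l k = 1 := by
    rw [μyx, μxy, neg_ratio, neg_ratio, ratio_mul, ← map_one (algebraMap P base.L), ratio_one]
    exact ratio_congr (S.mul_mem h2 h1) S.one_mem (by ring)
  rw [x_mul_y h.symm, ← mul_assoc, ← map_mul, h3, map_one, one_mul]

end So3
end RTGW

namespace RTGW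
open MvPolynomial

namespace Alg

variable {q m : ℕ} (D : Datum q m)

lemma inv_mk (g : Gen D) : inv D (mk D (FreeAlgebra.ι ℂ g)) = invGen D g := by
  have h2 : mk D (FreeAlgebra.ι ℂ g) = RingQuot.mkRingHom (Rel D) (FreeAlgebra.ι ℂ g) :=
    congrFun (congrArg DFunLike.coe (RingQuot.mkAlgHom_coe ℂ (Rel D))) _
  rw [h2]
  refine (RingQuot.lift_mkRingHom_apply _ _ _).trans ?_
  exact liftSemi_ι _ _ _

lemma inv_coef (f : D.L) : inv D (coef D f) = coef D (D.inv f) := inv_mk D _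

lemma inv_x (i : Fin q) : inv D (x D i) = y D i := inv_mk D _

lemma inv_y (i : Fin q) : inv D (y D i) = x D i := inv_mk D _

lemma perm_mk (g : blockGroup m D.storey) (a : Gen D) :
    perm D g (mk D (FreeAlgebra.ι ℂ a)) = permGen D g a := by
  refine (RingQuot.liftAlgHom_mkAlgHom_apply _ _ _ _).trans ?_
  exact FreeAlgebra.lift_ι_apply _ _

lemma perm_coef (g : blockGroup m D.storey) (f : D.L) :
    perm D g (coef D f) = coef D (D.perm g f) := perm_mk D g _

lemma perm_x (g : blockGroup m D.storey) (i : Fin q) : perm D g (x D i) = x D (g.1.1 i) :=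
  perm_mk D g _

lemma perm_y (g : blockGroup m D.storey) (i : Fin q) : perm D g (y D i) = y D (g.1.1 i) :=
  perm_mk D g _

end Alg

namespace So3

lemma add_mem_S' : (X i11 + X i21 : P) ∈ S := by
  rw [add_comm]
  exact add_mem_S i11 (by simp)

/-- `x₁₁ = (λ₁₁ - λ₂₁) X`. -/
def sX : 𝔄 := co (ratio 1 dd) * x11

/-- The inverse of `X`. -/
def sX' : 𝔄 := co (ratio 4 (X i11 + X i21)) * y11

/-- The inverse of `x₂₁`. -/
def sY' : 𝔄 := co (Ring.inverse (t 1)) * y21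

lemma x_co (k : Fin 2) (f : base.L) : Alg.x datum k * co f = co (base.σ k f) * Alg.x datum k :=
  Alg.x_coef datum k f

lemma y_co (k : Fin 2) (f : base.L) :
    Alg.y datum k * co f = co ((base.σ k).symm f) * Alg.y datum k :=
  Alg.y_coef datum k f

lemma x_mul_y_self (k : Fin 2) : Alg.x datum k * Alg.y datum k = co (base.σ k (t k)) :=
  Alg.x_y datum k

lemma y_mul_x_self (k : Fin 2) : Alg.y datum k * Alg.x datum k = co (t k) :=
  Alg.y_x datum k

lemma ratio_dd_mul : ratio 1 dd * algebraMap P base.L dd = 1 := by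
  rw [ratio, map_one, one_mul, Ring.inverse_mul_cancel _ (isUnit_S dd_mem_S)]

lemma isUnit_t_one : IsUnit (t 1) := datum.isUnit_t 1

lemma t_zero_mul_σ_symm : ratio 4 (X i11 + X i21) * ((base.σ 0).symm (ratio 1 dd) * t 0) = 1 := by
  rw [σ_symm_ratio _ dd_mem_S, t_zero, ratio_mul, ratio_mul, ← map_one (algebraMap P base.L),
    ratio_one]
  refine ratio_congr (S.mul_mem add_mem_S' (S.mul_mem (shift_symm_mem _ dd_mem_S) S.one_mem))
    S.one_mem ?_
  have h := quarter 1
  simp only [map_one, rg, st_X21, dd, map_sub, Base.shift_symm_X, if_true, Sum.inl.injEq,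
    one_ne_zero, if_false]
  linear_combination (X i11 + X i21) * (X i11 + (1 - X i21)) * h

lemma skewLaurent : SkewLaurent (base.σ 0) (base.σ 1) sX sX' x21 sY' where
  X_smul f r := by
    rw [smul_eq, smul_eq, sX, mul_assoc, ← mul_assoc x11, x_co]
    simp only [← mul_assoc, ← map_mul, mul_comm]
  X'_smul f r := by
    rw [smul_eq, smul_eq, sX', mul_assoc, ← mul_assoc y11, y_co]
    simp only [← mul_assoc, ← map_mul, mul_comm]
  Y_smul f r := by
    rw [smul_eq, smul_eq, ← mul_assoc x21, x_co, mul_assoc]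
  Y'_smul f r := by
    rw [smul_eq, smul_eq, sY', mul_assoc, ← mul_assoc y21, y_co]
    simp only [← mul_assoc, ← map_mul, mul_comm]
  X_X' := by
    have h := congrArg (base.σ 0) t_zero_mul_σ_symm
    simp only [map_mul, RingEquiv.apply_symm_apply, map_one] at h
    calc sX * sX' = co (ratio 1 dd) * (x11 * co (ratio 4 (X i11 + X i21))) * y11 := by
          rw [sX, sX']; noncomm_ring
      _ = co (ratio 1 dd) * co (base.σ 0 (ratio 4 (X i11 + X i21))) * (x11 * y11) := by
          rw [x_co]; noncomm_ring
      _ = 1 := by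
        rw [x_mul_y_self, ← map_mul, ← map_mul, ← map_one co, ← h]
        congr 1
        ring
  X'_X := by
    calc sX' * sX = co (ratio 4 (X i11 + X i21)) * (y11 * co (ratio 1 dd)) * x11 := by
          rw [sX, sX']; noncomm_ring
      _ = co (ratio 4 (X i11 + X i21)) * co ((base.σ 0).symm (ratio 1 dd)) * (y11 * x11) := by
          rw [y_co]; noncomm_ring
      _ = 1 := by
        rw [y_mul_x_self, ← map_mul, ← map_mul, ← map_one co, ← t_zero_mul_σ_symm, mul_assoc]
  Y_Y' := by
    rw [sY', ← mul_assoc, x_co, mul_assoc, x_mul_y_self, ← map_mul, ← map_mul,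
      Ring.inverse_mul_cancel _ isUnit_t_one, map_one, map_one]
  Y'_Y := by
    rw [sY', mul_assoc, y_mul_x_self, ← map_mul, Ring.inverse_mul_cancel _ isUnit_t_one, map_one]
  Y_X := by
    have h : base.σ 1 (ratio 1 dd) * μxx 1 0 = ratio 1 dd := by
      rw [μxx, σ_ratio _ dd_mem_S, neg_ratio, ratio_mul]
      have h10 : rg (Sum.inl 1) (Sum.inl 0) ∈ S := rg_mem (by decide)
      refine ratio_congr (S.mul_mem (shift_mem 1 dd_mem_S) h10) dd_mem_S ?_
      simp [dd, rg, st_X21, st_X11, Base.shift_X]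
      ring
    rw [sX, ← mul_assoc, x_co, mul_assoc, x_mul_x (by decide : (1 : Fin 2) ≠ 0), ← mul_assoc,
      ← map_mul, h, mul_assoc]

lemma x11_eq : x11 = (algebraMap P base.L (X i11) - algebraMap P base.L (X i21)) • sX := by
  rw [smul_eq, sX, ← mul_assoc, ← map_mul, ← map_sub, mul_comm (algebraMap P base.L _),
    show (X i11 - X i21 : P) = dd from rfl, ratio_dd_mul, map_one, one_mul]

lemma y11_eq : y11 = (algebraMap P base.L (C (1 / 4)) *
    (algebraMap P base.L (X i11) + algebraMap P base.L (X i21))) • sX' := by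
  have h : algebraMap P base.L (C (1 / 4)) *
      (algebraMap P base.L (X i11) + algebraMap P base.L (X i21)) *
        ratio 4 (X i11 + X i21) = 1 := by
    rw [← map_add, ← map_mul, ratio_one, ratio_mul, ← map_one (algebraMap P base.L), ratio_one]
    refine ratio_congr (S.mul_mem S.one_mem add_mem_S') S.one_mem ?_
    linear_combination (X i11 + X i21) * quarter 1
  rw [smul_eq, sX', ← mul_assoc, ← map_mul, h, map_one, one_mul]

lemma y21_eq : y21 =
    ((algebraMap P base.L (X i21) ^ 2 - algebraMap P base.L (X i11) ^ 2) * qq) • sY' := by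
  rw [smul_eq, sY', ← t_one_eq, ← mul_assoc, ← map_mul, Ring.mul_inverse_cancel _ isUnit_t_one,
    map_one, one_mul]

lemma σ_CC : base.σ 0 CC = CC - C' := by
  rw [CC_eq, map_mul, So3Coeff_L.σ_κ, So3Coeff_L.σ_a]
  ring

lemma σ_symm_CC : (base.σ 0).symm CC = CC + C' := by
  rw [RingEquiv.symm_apply_eq, map_add, σ_CC, So3Coeff_L.σ_κ, sub_add_cancel]

lemma U₁_mul_U₂ : U₁ * U₂ - U₂ * U₁ = U₃ := by
  have h10 : (1 : Fin 2) ≠ 0 := by decide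
  have h1 : x21 * x11 = co (μxx 1 0) * (x11 * x21) := x_mul_x h10
  have h2 : y21 * y11 = co (μyy 1 0) * (y11 * y21) := y_mul_y h10
  have h3 : x21 * y11 = co (μxy 1 0) * (y11 * x21) := x_mul_y h10
  have h4 : y21 * x11 = co (μyx 1 0) * (x11 * y21) := y_mul_x h10
  have h5 : x11 * co CC = co CC * x11 - co C' * x11 := by
    rw [x_co, σ_CC, map_sub, sub_mul]
  have h6 : y11 * co CC = co CC * y11 + co C' * y11 := by
    rw [y_co, σ_symm_CC, map_add, add_mul]
  rw [U₁, U₂, U₃]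
  simp only [map_sub, map_one, sub_mul, one_mul, mul_add, add_mul, mul_sub, mul_assoc, h1, h2, h3, h4,
    h5, h6]
  abel

lemma commutators : U₁ * U₂ - U₂ * U₁ = U₃ ∧ U₃ * U₁ - U₁ * U₃ = U₂ ∧ U₃ * U₂ - U₂ * U₃ = -U₁ := by
  have h := So3Coeff.commutators skewLaurent So3Coeff_L U₁ U₂ _
    (by rw [U₁]; conv_lhs => rw [x11_eq, y11_eq])
    (by
      rw [U₂]
      conv_lhs => rw [y21_eq]
      rw [← CC_eq, smul_eq CC, mul_one]) rfl
  rw [← h.1, U₁_mul_U₂] at h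
  exact ⟨U₁_mul_U₂, h.2⟩

lemma inv_C' : base.inv C' = -C' := by
  rw [C', inv_ratio C'_den_mem_S, neg_ratio]
  refine ratio_congr (st_mem C'_den_mem_S) C'_den_mem_S ?_
  simp [st_X21, st_X31, st_X32, Base.star_C]
  ring

lemma perm_C' (e : blockGroup 2 base.storey) : base.perm e C' = C' := by
  have h : ∏ j : Fin 2, (X (Sum.inr (e.1.2 j)) : P) = ∏ j : Fin 2, X (Sum.inr j) :=
    Equiv.prod_comp e.1.2 (fun j => (X (Sum.inr j) : P))
  rw [Fin.prod_univ_two, Fin.prod_univ_two] at h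
  rw [C', perm_ratio e C'_den_mem_S]
  congr 1
  · simp only [map_neg, map_mul, Base.permute_C, Base.permute_X, Equiv.sumCongr_apply,
      Sum.map_inr]
    rw [mul_assoc, h, mul_assoc]
  · simp only [map_mul, map_sub, map_one, permute_inl]

lemma inv_X11 : base.inv (algebraMap P base.L (X i11)) = -algebraMap P base.L (X i11) := by
  have h : starEquiv base.ζ (X i11) = -X i11 := st_X11
  rw [Base.inv_algebraMap, h, map_neg]

lemma inv_CC : base.inv CC = CC := by
  rw [CC_eq, map_mul, inv_C', inv_X11]
  ring

lemma perm_CC (e : blockGroup 2 base.storey) : base.perm e CC = CC := by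
  rw [CC_eq, map_mul, perm_C', Base.perm_algebraMap, permute_inl]

lemma inv_co (f : base.L) : Alg.inv datum (co f) = co (base.inv f) := Alg.inv_coef datum f

lemma perm_co_CC (e : blockGroup 2 datum.storey) : Alg.perm datum e (co CC) = co CC :=
  (Alg.perm_coef datum e CC).trans (congrArg co (perm_CC e))

lemma perm_x (e : blockGroup 2 datum.storey) (k : Fin 2) :
    Alg.perm datum e (Alg.x datum k) = Alg.x datum k := by
  have h := Alg.perm_x datum e k
  rwa [show e.1.1 k = k from perm_fst e k] at h

lemma perm_y (e : blockGroup 2 datum.storey) (k : Fin 2) :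
    Alg.perm datum e (Alg.y datum k) = Alg.y datum k := by
  have h := Alg.perm_y datum e k
  rwa [show e.1.1 k = k from perm_fst e k] at h

lemma U₁_mem_fixed : U₁ ∈ Alg.fixed datum := by
  refine ⟨?_, fun e => ?_⟩
  · rw [U₁, map_add, Alg.inv_x, Alg.inv_y, add_comm]
  · rw [U₁, map_add, perm_x, perm_y]

lemma U₂_mem_fixed : U₂ ∈ Alg.fixed datum := by
  refine ⟨?_, fun e => ?_⟩
  · rw [U₂, map_add, map_add, Alg.inv_x, Alg.inv_y, inv_co, inv_CC, add_comm x21]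
  · rw [U₂, map_add, map_add, perm_x, perm_y, perm_co_CC]

lemma U₃_mem_fixed : U₃ ∈ Alg.fixed datum := by
  rw [← U₁_mul_U₂]
  exact sub_mem (mul_mem U₁_mem_fixed U₂_mem_fixed) (mul_mem U₂_mem_fixed U₁_mem_fixed)

lemma algebraMap_L (c : ℂ) : algebraMap ℂ base.L c = algebraMap P base.L (C c) := by
  rw [IsScalarTower.algebraMap_apply ℂ P base.L]
  rfl

/-- The shift `σ_k` as a `ℂ`-algebra automorphism of `L`. -/
def shiftAlg (k : Fin 2) : base.L ≃ₐ[ℂ] base.L :=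
  AlgEquiv.ofRingEquiv (f := base.σ k) fun c => by
    rw [algebraMap_L, Base.σ_algebraMap, Base.shift_C]

lemma shiftAlg_apply (k : Fin 2) (f : base.L) : shiftAlg k f = base.σ k f := rfl

/-- The algebra of `ℂ`-linear operators on `L`. -/
def Op : Type := Module.End ℂ base.L

instance : Ring Op := inferInstanceAs (Ring (Module.End ℂ base.L))

instance : Algebra ℂ Op := inferInstanceAs (Algebra ℂ (Module.End ℂ base.L))

/-- The function on `L` underlying an operator. -/
def ev : Op →ₗ[ℂ] (base.L → base.L) where
  toFun T := fun v => (show Module.End ℂ base.L from T) v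
  map_add' _ _ := rfl
  map_smul' _ _ := rfl

lemma ev_injective : Function.Injective ev := fun _ _ h => LinearMap.coe_injective h

lemma ev_mul (T T' : Op) (v : base.L) : ev (T * T') v = ev T (ev T' v) := rfl

/-- The operator `f σ` on `L`, for `f ∈ L` and an automorphism `σ`. -/
def op (f : base.L) (φ : base.L ≃ₐ[ℂ] base.L) : Op :=
  (Algebra.lmul ℂ base.L f * AlgEquiv.toLinearMapHom ℂ base.L φ : Module.End ℂ base.L)

lemma ev_op (f : base.L) (φ : base.L ≃ₐ[ℂ] base.L) (v : base.L) : ev (op f φ) v = f * φ v := rfl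

lemma op_mul (f g : base.L) (φ χ : base.L ≃ₐ[ℂ] base.L) :
    op f φ * op g χ = op (f * φ g) (φ * χ) := by
  refine ev_injective (funext fun v => ?_)
  simp only [ev_mul, ev_op, AlgEquiv.mul_apply, map_mul, mul_assoc]

lemma op_algebraMap (c : ℂ) : op (algebraMap ℂ base.L c) 1 = algebraMap ℂ Op c := by
  refine ev_injective (funext fun v => ?_)
  exact (Algebra.smul_def c v).symm

lemma op_one_one : op 1 1 = 1 := by
  rw [← map_one (algebraMap ℂ base.L), op_algebraMap, map_one]

lemma op_add (f g : base.L) (φ : base.L ≃ₐ[ℂ] base.L) : op (f + g) φ = op f φ + op g φ := by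
  refine ev_injective (funext fun v => ?_)
  rw [map_add, Pi.add_apply, ev_op, ev_op, ev_op, add_mul]

lemma op_sub (f g : base.L) (φ : base.L ≃ₐ[ℂ] base.L) : op (f - g) φ = op f φ - op g φ := by
  rw [eq_sub_iff_add_eq, ← op_add, sub_add_cancel]

lemma op_neg (f : base.L) (φ : base.L ≃ₐ[ℂ] base.L) : op (-f) φ = -op f φ := by
  rw [eq_neg_iff_add_eq_zero, ← op_add, neg_add_cancel]
  refine ev_injective (funext fun v => ?_)
  rw [ev_op, zero_mul, map_zero, Pi.zero_apply]

lemma σ_comm (k l : Fin 2) (f : base.L) : base.σ k (base.σ l f) = base.σ l (base.σ k f) := by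
  have h := So3Coeff_L.σ_τ
  fin_cases k <;> fin_cases l
  · rfl
  · exact h f
  · exact (h f).symm
  · rfl

lemma shiftAlg_comm (k l : Fin 2) : shiftAlg k * shiftAlg l = shiftAlg l * shiftAlg k :=
  AlgEquiv.ext fun f => σ_comm k l f

/-- The coefficient of `σ_k` in the operator representing `x_k`. -/
def xCoeff : Fin 2 → base.L := ![ratio dd 1, 1]

/-- The coefficient of `σ_k⁻¹` in the operator representing `y_k`. -/
def yCoeff : Fin 2 → base.L := ![ratio (C (1 / 4) * (X i11 + X i21)) 1, t 1]

lemma yCoeff_mul (k : Fin 2) : yCoeff k * (base.σ k).symm (xCoeff k) = t k := by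
  fin_cases k
  · change ratio _ 1 * (base.σ 0).symm (ratio dd 1) = t 0
    rw [σ_symm_ratio _ S.one_mem, t_zero, ratio_mul]
    refine ratio_congr (S.mul_mem S.one_mem (shift_symm_mem _ S.one_mem)) S.one_mem ?_
    simp [dd, rg, st_X21, Base.shift_symm_X]
    ring
  · change t 1 * (base.σ 1).symm 1 = t 1
    rw [map_one, mul_one]

lemma xCoeff_mul (k : Fin 2) : xCoeff k * base.σ k (yCoeff k) = base.σ k (t k) := by
  rw [← yCoeff_mul, map_mul, RingEquiv.apply_symm_apply, mul_comm]

lemma xCoeff_mul_σ (k l : Fin 2) :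
    xCoeff k * base.σ k (xCoeff l) = μ k l * (xCoeff l * base.σ l (xCoeff k)) := by
  by_cases h : k = l
  · subst h
    simp [μ]
  rw [μ_ne h]
  have h1 := rg_mem h
  fin_cases k <;> fin_cases l
  · exact absurd rfl h
  · change ratio dd 1 * base.σ 0 1 = ratio _ _ * (1 * base.σ 1 (ratio dd 1))
    rw [map_one, mul_one, one_mul, σ_ratio _ S.one_mem, ratio_mul]
    refine ratio_congr S.one_mem (S.mul_mem h1 (shift_mem _ S.one_mem)) ?_
    simp [dd, rg, st_X11, st_X21, Base.shift_X]
    ring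
  · change 1 * base.σ 1 (ratio dd 1) = ratio _ _ * (ratio dd 1 * base.σ 0 1)
    rw [map_one, mul_one, one_mul, σ_ratio _ S.one_mem, ratio_mul]
    refine ratio_congr (shift_mem _ S.one_mem) (S.mul_mem h1 S.one_mem) ?_
    simp [dd, rg, st_X11, st_X21, Base.shift_X]
    ring
  · exact absurd rfl h

lemma yCoeff_mul_σ (k l : Fin 2) :
    yCoeff k * (base.σ k).symm (yCoeff l) =
      base.inv (μ k l) * (yCoeff l * (base.σ l).symm (yCoeff k)) := by
  by_cases h : k = l
  · subst h
    simp [μ]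
  rw [μ_ne h, inv_ratio (rg_mem h)]
  have h1 := st_mem (rg_mem h)
  fin_cases k <;> fin_cases l
  · exact absurd rfl h
  · change ratio _ 1 * (base.σ 0).symm (t 1) = ratio _ _ * (t 1 * (base.σ 1).symm (ratio _ 1))
    rw [t_one, σ_symm_ratio _ h21_mem_S, σ_symm_ratio _ S.one_mem, ratio_mul, ratio_mul, ratio_mul]
    refine ratio_congr (S.mul_mem S.one_mem (shift_symm_mem _ h21_mem_S))
      (S.mul_mem h1 (S.mul_mem h21_mem_S (shift_symm_mem _ S.one_mem))) ?_
    simp [h21_eq, rg, st_X11, st_X21, st_X31, st_X32, Base.shift_symm_X, shift_symm_C]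
    ring
  · change t 1 * (base.σ 1).symm (ratio _ 1) = ratio _ _ * (ratio _ 1 * (base.σ 0).symm (t 1))
    rw [t_one, σ_symm_ratio _ h21_mem_S, σ_symm_ratio _ S.one_mem, ratio_mul, ratio_mul, ratio_mul]
    refine ratio_congr (S.mul_mem h21_mem_S (shift_symm_mem _ S.one_mem))
      (S.mul_mem h1 (S.mul_mem S.one_mem (shift_symm_mem _ h21_mem_S))) ?_
    simp [h21_eq, rg, st_X11, st_X21, st_X31, st_X32, Base.shift_symm_X, shift_symm_C]
    ring
  · exact absurd rfl h

open LaurentPolynomial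

/-- The algebra of Laurent polynomials over the operators on `L`. -/
abbrev GradedOp : Type := Op[T;T⁻¹]

/-- The monomial `f σ Tⁿ`. -/
def mono (n : ℤ) (f : base.L) (φ : base.L ≃ₐ[ℂ] base.L) : GradedOp :=
  AddMonoidAlgebra.single n (op f φ)

lemma mono_mul (n m : ℤ) (f g : base.L) (φ χ : base.L ≃ₐ[ℂ] base.L) :
    mono n f φ * mono m g χ = mono (n + m) (f * φ g) (φ * χ) := by
  rw [mono, mono, AddMonoidAlgebra.single_mul_single, op_mul, mono]

lemma mono_zero_mul (m : ℤ) (f g : base.L) (φ : base.L ≃ₐ[ℂ] base.L) :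
    mono 0 f 1 * mono m g φ = mono m (f * g) φ := by
  rw [mono_mul, zero_add, one_mul, AlgEquiv.one_apply]

lemma mono_mul_zero (m : ℤ) (f g : base.L) (φ : base.L ≃ₐ[ℂ] base.L) :
    mono m f φ * mono 0 g 1 = mono 0 (φ g) 1 * mono m f φ := by
  rw [mono_mul, mono_zero_mul, add_zero, mul_one, mul_comm]

lemma mono_add (f g : base.L) : mono 0 (f + g) 1 = mono 0 f 1 + mono 0 g 1 := by
  rw [mono, op_add]
  exact AddMonoidAlgebra.single_add _ _ _

lemma mono_algebraMap (c : ℂ) :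
    mono 0 (algebraMap P base.L (C c)) 1 = algebraMap ℂ GradedOp c := by
  rw [AddMonoidAlgebra.coe_algebraMap, Function.comp_apply, ← op_algebraMap, algebraMap_L]
  rfl

/-- The operator representing `x_k`. -/
def repX (k : Fin 2) : GradedOp := mono 1 (xCoeff k) (shiftAlg k)

/-- The operator representing `y_k`. -/
def repY (k : Fin 2) : GradedOp := mono (-1) (yCoeff k) (shiftAlg k)⁻¹

lemma repY_mul_repX (k : Fin 2) : repY k * repX k = mono 0 (t k) 1 := by
  rw [repX, repY, mono_mul, inv_mul_cancel, ← yCoeff_mul]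
  rfl

lemma repX_mul_repY (k : Fin 2) : repX k * repY k = mono 0 (base.σ k (t k)) 1 := by
  rw [repX, repY, mono_mul, mul_inv_cancel, ← xCoeff_mul]
  rfl

lemma repX_mul_repX (k l : Fin 2) : repX k * repX l = mono 0 (μ k l) 1 * (repX l * repX k) := by
  rw [repX, repX, mono_mul, mono_mul, mono_zero_mul, shiftAlg_comm k l, shiftAlg_apply,
    shiftAlg_apply, xCoeff_mul_σ]

lemma repY_mul_repY (k l : Fin 2) :
    repY k * repY l = mono 0 (base.inv (μ k l)) 1 * (repY l * repY k) := by
  rw [repY, repY, mono_mul, mono_mul, mono_zero_mul, ← mul_inv_rev, ← mul_inv_rev, shiftAlg_comm k l]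
  exact congrArg (fun c => mono (-1 + -1) c (shiftAlg l * shiftAlg k)⁻¹) (yCoeff_mul_σ k l)

/-- Values of the graded representation on the generators. -/
def repGen : Gen datum → GradedOp
  | Gen.coef f => mono 0 f 1
  | Gen.x k => repX k
  | Gen.y k => repY k

/-- The graded representation of `𝔄`. -/
def rep : 𝔄 →ₐ[ℂ] GradedOp :=
  RingQuot.liftAlgHom ℂ ⟨FreeAlgebra.lift ℂ repGen, by
    intro u v h
    cases h <;> simp only [map_mul, map_add, AlgHom.commutes, FreeAlgebra.lift_ι_apply]
    case coef_add f g => exact mono_add f g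
    case coef_mul f g => exact (mono_zero_mul 0 f g 1).symm
    case coef_scalar c => exact mono_algebraMap c
    case x_coef k f => exact mono_mul_zero _ _ _ _
    case y_coef k f => exact mono_mul_zero _ _ _ _
    case y_x k => exact repY_mul_repX k
    case x_y k => exact repX_mul_repY k
    case x_x k l => exact repX_mul_repX k l
    case y_y k l => exact repY_mul_repY k l⟩

lemma rep_mk (g : Gen datum) : rep (Alg.mk datum (FreeAlgebra.ι ℂ g)) = repGen g := by
  refine (RingQuot.liftAlgHom_mkAlgHom_apply _ _ _ _).trans ?_
  exact FreeAlgebra.lift_ι_apply _ _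

lemma rep_co (f : base.L) : rep (co f) = mono 0 f 1 := rep_mk _

lemma rep_x (k : Fin 2) : rep (Alg.x datum k) = repX k := rep_mk _

lemma rep_y (k : Fin 2) : rep (Alg.y datum k) = repY k := rep_mk _

lemma co_injective : Function.Injective co := by
  intro f g h
  have h1 := congrArg (fun u : 𝔄 => ev ((rep u).coeff 0) 1) h
  simp only [rep_co, mono, AddMonoidAlgebra.coeff_single, Finsupp.single_eq_same, ev_op] at h1
  simpa using h1

lemma hasTop_mono (n : ℤ) (f : base.L) (φ : base.L ≃ₐ[ℂ] base.L) :
    HasTop (mono n f φ) n (op f φ) := hasTop_single _ _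

/-- The leading operator of `U₁`. -/
abbrev top₁ : Op := op (xCoeff 0) (shiftAlg 0)

/-- The leading operator of `U₂`. -/
abbrev top₂ : Op := op 1 (shiftAlg 1)

lemma hasTop_U₁ : HasTop (rep U₁) 1 top₁ := by
  rw [U₁, map_add, rep_x, rep_y]
  exact (hasTop_mono _ _ _).add_of_lt (hasTop_mono _ _ _) (by norm_num)

lemma hasTop_U₂ : HasTop (rep U₂) 1 top₂ := by
  rw [U₂, map_add, map_add, rep_x, rep_y, rep_co]
  exact ((hasTop_mono _ _ _).add_of_lt (hasTop_mono _ _ _) (by norm_num)).add_of_lt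
    (hasTop_mono _ _ _) (by norm_num)

lemma hasTop_U₃ : HasTop (rep U₃) 2 (-op 1 (shiftAlg 0 * shiftAlg 1)) := by
  have h : top₁ * top₂ - top₂ * top₁ = -op 1 (shiftAlg 0 * shiftAlg 1) := by
    have hd : xCoeff 0 - base.σ 1 (xCoeff 0) = -1 := by
      change ratio dd 1 - base.σ 1 (ratio dd 1) = -1
      rw [σ_ratio _ S.one_mem, map_one, ← ratio_one, ← ratio_one, ← map_sub,
        ← map_one (algebraMap P base.L), ← map_neg]
      congr 1
      simp [dd, Base.shift_X]
    rw [op_mul, op_mul, shiftAlg_comm 1 0, shiftAlg_apply 1, map_one, mul_one, one_mul, ← op_sub, hd,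
      op_neg]
  rw [← U₁_mul_U₂, ← h, map_sub, map_mul, map_mul]
  exact (hasTop_U₁.mul hasTop_U₂).sub (hasTop_U₂.mul hasTop_U₁)

/-- The falling factorial `d (d - 1) ⋯ (d - a + 1)`. -/
def falling (a : ℕ) : base.L :=
  Polynomial.aeval (algebraMap P base.L dd) (descPochhammer ℂ a)

lemma falling_succ (a : ℕ) : falling (a + 1) = falling a * (algebraMap P base.L dd - a) := by
  rw [falling, descPochhammer_succ_right, map_mul, falling, map_sub, Polynomial.aeval_X, map_natCast]

lemma shiftAlg_pow_dd (a : ℕ) :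
    (shiftAlg 0 ^ a) (algebraMap P base.L dd) = algebraMap P base.L dd - a := by
  induction a with
  | zero => simp
  | succ a ih =>
    rw [pow_succ', AlgEquiv.mul_apply, ih, map_sub, map_natCast, shiftAlg_apply,
      Base.σ_algebraMap]
    simp [dd, Base.shift_X]
    ring

lemma top₁_pow (a : ℕ) : top₁ ^ a = op (falling a) (shiftAlg 0 ^ a) := by
  have h : xCoeff 0 = algebraMap P base.L dd := (ratio_one dd).symm
  induction a with
  | zero =>
    rw [pow_zero, pow_zero, ← op_one_one, falling, descPochhammer_zero, map_one]
  | succ a ih => rw [pow_succ, ih, op_mul, h, shiftAlg_pow_dd, falling_succ, pow_succ]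

lemma op_one_pow (φ : base.L ≃ₐ[ℂ] base.L) (a : ℕ) : op 1 φ ^ a = op 1 (φ ^ a) := by
  induction a with
  | zero => rw [pow_zero, pow_zero, op_one_one]
  | succ a ih => rw [pow_succ, ih, op_mul, map_one, mul_one, pow_succ]

lemma le_nonZeroDivisors : base.S ≤ nonZeroDivisors P :=
  le_nonZeroDivisors_of_noZeroDivisors base.zero_notMem

instance : IsDomain base.L := IsLocalization.isDomain_of_le_nonZeroDivisors base.L le_nonZeroDivisors

lemma algebraMap_injective : Function.Injective (algebraMap P base.L) :=
  IsLocalization.injective base.L le_nonZeroDivisors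

lemma linearIndependent_falling : LinearIndependent ℂ falling := by
  have h1 : LinearIndependent ℂ (fun a => descPochhammer ℂ a) := by
    refine Polynomial.Sequence.linearIndependent
      ⟨fun a => descPochhammer ℂ a, fun a => ?_⟩
    rw [Polynomial.degree_eq_natDegree (monic_descPochhammer ℂ a).ne_zero,
      descPochhammer_natDegree]
  have h2 : Function.Injective (Polynomial.aeval (R := ℂ) (dd : P)) := by
    have h : (MvPolynomial.aeval (fun j => if j = i11 then (Polynomial.X : Polynomial ℂ) else 0)).comp
        (Polynomial.aeval (R := ℂ) (dd : P)) = AlgHom.id ℂ (Polynomial ℂ) := by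
      ext
      simp [dd]
    intro f g hfg
    have := congrArg (fun φ : Polynomial ℂ →ₐ[ℂ] Polynomial ℂ => φ f - φ g) h
    simp only [AlgHom.comp_apply, AlgHom.id_apply, hfg, sub_self] at this
    exact (sub_eq_zero.mp this.symm)
  have h3 : Function.Injective (Polynomial.aeval (R := ℂ) (algebraMap P base.L dd)) := by
    intro f g hfg
    rw [Polynomial.aeval_algebraMap_apply, Polynomial.aeval_algebraMap_apply] at hfg
    exact h2 (algebraMap_injective hfg)
  exact h1.map_injOn (Polynomial.aeval (algebraMap P base.L dd)).toLinearMap h3.injOn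

lemma shiftAlg_pow_mul_apply (p r : ℕ) :
    (shiftAlg 0 ^ p * shiftAlg 1 ^ r) (algebraMap P base.L (X i11)) =
        algebraMap P base.L (X i11) - p ∧
      (shiftAlg 0 ^ p * shiftAlg 1 ^ r) (algebraMap P base.L (X i21)) =
        algebraMap P base.L (X i21) - r := by
  have h : ∀ (k l : Fin 2) (n : ℕ), (shiftAlg k ^ n) (algebraMap P base.L (X (Sum.inl l))) =
      algebraMap P base.L (X (Sum.inl l)) - if l = k then (n : base.L) else 0 := by
    intro k l n
    induction n with
    | zero => simp
    | succ n ih =>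
      rw [pow_succ', AlgEquiv.mul_apply, ih, map_sub, shiftAlg_apply, Base.σ_algebraMap,
        Base.shift_X]
      by_cases hkl : l = k
      · simp [hkl]
        ring
      · simp [hkl]
  constructor
  · rw [AlgEquiv.mul_apply, h, map_sub, h]
    simp
  · rw [AlgEquiv.mul_apply, h, map_sub, h]
    simp

/-- The automorphism `σ₁₁ᵖ σ₂₁ʳ` of `L` as a monoid homomorphism. -/
def shiftMonoidHom (n : ℕ × ℕ) : base.L →* base.L :=
  ((shiftAlg 0 ^ n.1 * shiftAlg 1 ^ n.2 : base.L ≃ₐ[ℂ] base.L) : base.L →* base.L)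

lemma shiftMonoidHom_apply (n : ℕ × ℕ) (v : base.L) :
    shiftMonoidHom n v = (shiftAlg 0 ^ n.1 * shiftAlg 1 ^ n.2 : base.L ≃ₐ[ℂ] base.L) v := rfl

lemma shiftMonoidHom_injective : Function.Injective shiftMonoidHom := by
  have hc : Function.Injective (Nat.cast : ℕ → base.L) := by
    intro a b h
    rw [← map_natCast (algebraMap P base.L), ← map_natCast (algebraMap P base.L)] at h
    exact Nat.cast_injective (algebraMap_injective h)
  rintro ⟨p, r⟩ ⟨p', r'⟩ h
  have h1 := congrArg (fun φ : base.L →* base.L => φ (algebraMap P base.L (X i11))) h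
  have h2 := congrArg (fun φ : base.L →* base.L => φ (algebraMap P base.L (X i21))) h
  simp only [shiftMonoidHom_apply, (shiftAlg_pow_mul_apply _ _).1] at h1
  simp only [shiftMonoidHom_apply, (shiftAlg_pow_mul_apply _ _).2] at h2
  exact Prod.ext (hc (sub_right_injective h1)) (hc (sub_right_injective h2))

/-- The leading operator of `U₁ᵃ U₂ᵇ U₃ᶜ`. -/
def topMonomial (k : ℕ × ℕ × ℕ) : Op :=
  top₁ ^ k.1 * top₂ ^ k.2.1 * (-op 1 (shiftAlg 0 * shiftAlg 1)) ^ k.2.2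

lemma topMonomial_apply (k : ℕ × ℕ × ℕ) (v : base.L) :
    ev (topMonomial k) v = ((-1 : ℂˣ) ^ k.2.2) •
      (falling k.1 * shiftMonoidHom (k.1 + k.2.2, k.2.1 + k.2.2) v) := by
  have hcomm : Commute (shiftAlg 0) (shiftAlg 1) := shiftAlg_comm 0 1
  have h : shiftAlg 0 ^ k.1 * shiftAlg 1 ^ k.2.1 * (shiftAlg 0 * shiftAlg 1) ^ k.2.2 =
      shiftAlg 0 ^ (k.1 + k.2.2) * shiftAlg 1 ^ (k.2.1 + k.2.2) := by
    rw [hcomm.mul_pow, mul_assoc, ← mul_assoc (shiftAlg 1 ^ k.2.1),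
      (hcomm.symm.pow_pow _ _).eq]
    simp only [pow_add, mul_assoc]
  have h' : topMonomial k = (-1) ^ k.2.2 * op (falling k.1)
      (shiftAlg 0 ^ (k.1 + k.2.2) * shiftAlg 1 ^ (k.2.1 + k.2.2)) := by
    rw [topMonomial, top₁_pow, op_one_pow, neg_pow (op 1 _), op_one_pow, ← mul_assoc,
      ((Commute.neg_one_right _).pow_right _).eq, mul_assoc, op_mul, op_mul, map_one, map_one, mul_one,
      mul_one, h]
  rw [h', shiftMonoidHom_apply]
  rcases Nat.even_or_odd k.2.2 with hk | hk
  · rw [hk.neg_one_pow, hk.neg_one_pow, one_mul, one_smul, ev_op]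
  · rw [hk.neg_one_pow, hk.neg_one_pow, neg_one_mul, map_neg, Pi.neg_apply, ev_op]
    exact (neg_one_smul ℂ _).symm

lemma linearIndependent_topMonomial : LinearIndependent ℂ topMonomial := by
  have h1 : LinearIndependent base.L (fun n => (shiftMonoidHom n : base.L → base.L)) :=
    (linearIndependent_monoidHom base.L base.L).comp _ shiftMonoidHom_injective
  have h2 := linearIndependent_smul linearIndependent_falling h1
  let j : ℕ × ℕ × ℕ → ℕ × (ℕ × ℕ) := fun k => (k.1, (k.1 + k.2.2, k.2.1 + k.2.2))
  have hj : Function.Injective j := by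
    rintro ⟨a, b, c⟩ ⟨a', b', c'⟩ h
    simp only [j, Prod.mk.injEq] at h ⊢
    omega
  have h3 := (h2.comp j hj).units_smul (fun k => (-1 : ℂˣ) ^ k.2.2)
  refine LinearIndependent.of_comp ev ?_
  convert h3 using 1
  funext k v
  exact topMonomial_apply k v

lemma linearIndependent_orderedMonomial :
    LinearIndependent ℂ (orderedMonomial U₁ U₂ U₃) := by
  refine LinearIndependent.of_comp rep.toLinearMap ?_
  refine linearIndependent_of_hasTop (w := fun k => k.1 * 1 + k.2.1 * 1 + k.2.2 * 2) (fun k => ?_)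
    linearIndependent_topMonomial
  change HasTop (rep (orderedMonomial U₁ U₂ U₃ k)) _ _
  rw [map_orderedMonomial]
  exact ((hasTop_U₁.pow _).mul (hasTop_U₂.pow _)).mul (hasTop_U₃.pow _)

end So3
end RTGW

namespace RTGW

open UniversalEnvelopingAlgebra in
lemma range_lift {k 𝔏 A : Type*} [Field k] [LieRing 𝔏] [LieAlgebra k 𝔏] [Ring A] [Algebra k A]
    (f : 𝔏 →ₗ⁅k⁆ A) {s : Set 𝔏} (hs : Submodule.span k s = ⊤) :
    (lift k f).range = Algebra.adjoin k (f '' s) := by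
  rw [← Algebra.map_top, ← adjoin_ι_eq_top hs, AlgHom.map_adjoin, Set.image_image]
  simp only [lift_ι_apply]

namespace So3

lemma so3_apply (a : so3) (i j : Fin 3) : a.1 j i = -a.1 i j := by
  have h := (LieAlgebra.Orthogonal.mem_so _ _ _).mp a.2
  exact congrFun (congrFun h i) j

lemma so3_diag (a : so3) (i : Fin 3) : a.1 i i = 0 := self_eq_neg.mp (so3_apply a i i)

lemma so3_eq (a : so3) : a = a.1 2 1 • Lx + a.1 0 2 • Ly + a.1 1 0 • Lz := by
  have h1 := so3_apply a 2 1
  have h2 := so3_apply a 0 2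
  have h3 := so3_apply a 1 0
  apply Subtype.ext
  ext i j
  fin_cases i <;> fin_cases j <;> simp [Lx, Ly, Lz, so3_diag, h1, h2, h3]

lemma span_so3 : Submodule.span ℂ {Lx, Ly, Lz} = ⊤ := by
  rw [eq_top_iff]
  intro a _
  rw [so3_eq a]
  refine add_mem (add_mem ?_ ?_) ?_ <;>
    exact Submodule.smul_mem _ _ (Submodule.subset_span (by simp))

lemma Lx_lie_Ly : ⁅Lx, Ly⁆ = Lz := by
  apply Subtype.ext
  rw [LieSubalgebra.coe_bracket, Ring.lie_def]
  ext i j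
  fin_cases i <;> fin_cases j <;> simp [Lx, Ly, Lz]

lemma Lz_lie_Lx : ⁅Lz, Lx⁆ = Ly := by
  apply Subtype.ext
  rw [LieSubalgebra.coe_bracket, Ring.lie_def]
  ext i j
  fin_cases i <;> fin_cases j <;> simp [Lx, Ly, Lz]

lemma Lz_lie_Ly : ⁅Lz, Ly⁆ = -Lx := by
  apply Subtype.ext
  rw [LieSubalgebra.coe_bracket, Ring.lie_def]
  ext i j
  fin_cases i <;> fin_cases j <;> simp [Lx, Ly, Lz]

/-- The Lie algebra homomorphism `so(3;ℂ) → 𝔄` with `L_x ↦ U₁`, `L_y ↦ U₂`, `L_z ↦ U₃`. -/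
def so3Hom : so3 →ₗ⁅ℂ⁆ 𝔄 where
  toFun a := a.1 2 1 • U₁ + a.1 0 2 • U₂ + a.1 1 0 • U₃
  map_add' a b := by
    change (a.1 2 1 + b.1 2 1) • U₁ + (a.1 0 2 + b.1 0 2) • U₂ + (a.1 1 0 + b.1 1 0) • U₃ = _
    module
  map_smul' c a := by
    change (c * a.1 2 1) • U₁ + (c * a.1 0 2) • U₂ + (c * a.1 1 0) • U₃ = _
    simp only [smul_add, smul_smul, RingHom.id_apply]
  map_lie' {a b} := by
    obtain ⟨h12, h31, h32⟩ := commutators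
    have e1 : ⁅a, b⁆.1 2 1 = a.1 0 2 * b.1 1 0 - a.1 1 0 * b.1 0 2 := by
      rw [LieSubalgebra.coe_bracket, Ring.lie_def]
      simp only [Matrix.sub_apply, Matrix.mul_apply, Fin.sum_univ_three, so3_diag]
      rw [so3_apply a 0 2, so3_apply b 0 2, so3_apply a 1 0, so3_apply b 1 0]
      ring
    have e2 : ⁅a, b⁆.1 0 2 = a.1 1 0 * b.1 2 1 - a.1 2 1 * b.1 1 0 := by
      rw [LieSubalgebra.coe_bracket, Ring.lie_def]
      simp only [Matrix.sub_apply, Matrix.mul_apply, Fin.sum_univ_three, so3_diag]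
      rw [so3_apply a 2 1, so3_apply b 2 1, so3_apply a 1 0, so3_apply b 1 0]
      ring
    have e3 : ⁅a, b⁆.1 1 0 = a.1 2 1 * b.1 0 2 - a.1 0 2 * b.1 2 1 := by
      rw [LieSubalgebra.coe_bracket, Ring.lie_def]
      simp only [Matrix.sub_apply, Matrix.mul_apply, Fin.sum_univ_three, so3_diag]
      rw [so3_apply a 2 1, so3_apply b 2 1, so3_apply a 0 2, so3_apply b 0 2]
      ring
    simp only [e1, e2, e3, Ring.lie_def, add_mul, mul_add, smul_mul_assoc, mul_smul_comm]
    rw [sub_eq_iff_eq_add] at h12 h31 h32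
    rw [h12, h31, h32]
    module

lemma so3Hom_apply (a : so3) :
    so3Hom a = a.1 2 1 • U₁ + a.1 0 2 • U₂ + a.1 1 0 • U₃ := rfl

lemma so3Hom_Lx : so3Hom Lx = U₁ := by simp [so3Hom_apply, Lx]

lemma so3Hom_Ly : so3Hom Ly = U₂ := by simp [so3Hom_apply, Ly]

lemma so3Hom_Lz : so3Hom Lz = U₃ := by simp [so3Hom_apply, Lz]

lemma so3Hom_injective : Function.Injective so3Hom := by
  let j : Fin 3 → ℕ × ℕ × ℕ := ![(1, 0, 0), (0, 1, 0), (0, 0, 1)]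
  have hj : Function.Injective j := by decide
  have h := Fintype.linearIndependent_iff.mp (linearIndependent_orderedMonomial.comp j hj)
  rw [injective_iff_map_eq_zero]
  intro a ha
  have h0 := h ![a.1 2 1, a.1 0 2, a.1 1 0] (by
    rw [so3Hom_apply] at ha
    rw [Fin.sum_univ_three]
    simpa [j, orderedMonomial] using ha)
  have h1 : a.1 2 1 = 0 := h0 0
  have h2 : a.1 0 2 = 0 := h0 1
  have h3 : a.1 1 0 = 0 := h0 2
  rw [so3_eq a, h1, h2, h3]
  simp

lemma image_so3Hom : so3Hom '' {Lx, Ly, Lz} = {U₁, U₂, U₃} := by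
  rw [Set.image_insert_eq, Set.image_pair, so3Hom_Lx, so3Hom_Ly, so3Hom_Lz]

lemma range_so3Hom : so3Hom.range = 𝔤 := by
  apply le_antisymm
  · rintro _ ⟨a, rfl⟩
    change so3Hom a ∈ 𝔤
    rw [so3Hom_apply]
    refine add_mem (add_mem ?_ ?_) ?_ <;>
      exact 𝔤.smul_mem _ (LieSubalgebra.subset_lieSpan (by simp))
  · refine LieSubalgebra.lieSpan_le.mpr ?_
    rw [← image_so3Hom]
    rintro _ ⟨a, -, rfl⟩
    exact ⟨a, rfl⟩

/-- The isomorphism of Lie algebras `so(3;ℂ) ≃ 𝔤_so(3;ℂ)`. -/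
def so3Equiv : so3 ≃ₗ⁅ℂ⁆ 𝔤 :=
  (LieEquiv.ofInjective so3Hom so3Hom_injective).trans
    (LieEquiv.ofEq _ _ (congrArg (fun N : LieSubalgebra ℂ 𝔄 => (N : Set 𝔄)) range_so3Hom))

lemma so3Equiv_apply (a : so3) : (so3Equiv a : 𝔄) = so3Hom a := rfl

lemma adjoin_U_le : Algebra.adjoin ℂ {U₁, U₂, U₃} ≤ Alg.invariants datum := by
  refine Algebra.adjoin_mono ?_
  rintro _ (rfl | rfl | rfl)
  · exact U₁_mem_fixed
  · exact U₂_mem_fixed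
  · exact U₃_mem_fixed

lemma range_lift_so3Hom :
    (UniversalEnvelopingAlgebra.lift ℂ so3Hom).range = Algebra.adjoin ℂ {U₁, U₂, U₃} := by
  rw [range_lift so3Hom span_so3, image_so3Hom]

lemma lift_so3Hom_injective : Function.Injective (UniversalEnvelopingAlgebra.lift ℂ so3Hom) := by
  refine lift_injective span_so3 Lx_lie_Ly Lz_lie_Lx Lz_lie_Ly ?_
  rw [so3Hom_Lx, so3Hom_Ly, so3Hom_Lz]
  exact linearIndependent_orderedMonomial

lemma span_𝔤 : Submodule.span ℂ {so3Equiv Lx, so3Equiv Ly, so3Equiv Lz} = ⊤ := by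
  have h := congrArg (Submodule.map so3Equiv.toLinearEquiv.toLinearMap) span_so3
  rw [Submodule.map_span, Submodule.map_top, LinearEquiv.range, Set.image_insert_eq,
    Set.image_pair] at h
  exact h

lemma lift_incl_injective : Function.Injective (UniversalEnvelopingAlgebra.lift ℂ 𝔤.incl) := by
  refine lift_injective span_𝔤 ?_ ?_ ?_ ?_
  · rw [← LieEquiv.map_lie, Lx_lie_Ly]
  · rw [← LieEquiv.map_lie, Lz_lie_Lx]
  · rw [← LieEquiv.map_lie, Lz_lie_Ly, map_neg]
  · simp only [LieSubalgebra.coe_incl, so3Equiv_apply, so3Hom_Lx, so3Hom_Ly, so3Hom_Lz]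
    exact linearIndependent_orderedMonomial

lemma range_lift_incl_le :
    (UniversalEnvelopingAlgebra.lift ℂ 𝔤.incl).range ≤ Alg.invariants datum := by
  rw [range_lift 𝔤.incl span_𝔤, Set.image_insert_eq, Set.image_pair]
  simp only [LieSubalgebra.coe_incl, so3Equiv_apply, so3Hom_Lx, so3Hom_Ly, so3Hom_Lz]
  exact adjoin_U_le

/-- The homomorphism `U(so(3;ℂ)) → 𝔄^G`. -/
def envelopingHom : UniversalEnvelopingAlgebra ℂ so3 →ₐ[ℂ] Alg.invariants datum :=
  (UniversalEnvelopingAlgebra.lift ℂ so3Hom).codRestrict _ fun u =>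
    adjoin_U_le (range_lift_so3Hom ▸ ⟨u, rfl⟩)

lemma envelopingHom_apply (u : UniversalEnvelopingAlgebra ℂ so3) :
    (envelopingHom u : 𝔄) = UniversalEnvelopingAlgebra.lift ℂ so3Hom u := rfl

lemma envelopingHom_ι (a : so3) :
    (envelopingHom (UniversalEnvelopingAlgebra.ι ℂ a) : 𝔄) = so3Hom a := by
  rw [envelopingHom_apply, UniversalEnvelopingAlgebra.lift_ι_apply]

lemma envelopingHom_injective : Function.Injective envelopingHom := fun _ _ h =>
  lift_so3Hom_injective (congrArg Subtype.val h)

lemma envelopingHom_mem_fixed {u : UniversalEnvelopingAlgebra ℂ so3}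
    (hu : u ∈ Algebra.adjoin ℝ {UniversalEnvelopingAlgebra.ι ℂ Lx,
      UniversalEnvelopingAlgebra.ι ℂ Ly, UniversalEnvelopingAlgebra.ι ℂ Lz}) :
    (envelopingHom u : 𝔄) ∈ Alg.fixed datum := by
  rw [envelopingHom_apply]
  induction hu using Algebra.adjoin_induction with
  | mem u hu =>
    rcases hu with rfl | rfl | rfl
    · rw [UniversalEnvelopingAlgebra.lift_ι_apply, so3Hom_Lx]; exact U₁_mem_fixed
    · rw [UniversalEnvelopingAlgebra.lift_ι_apply, so3Hom_Ly]; exact U₂_mem_fixed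
    · rw [UniversalEnvelopingAlgebra.lift_ι_apply, so3Hom_Lz]; exact U₃_mem_fixed
  | algebraMap r =>
    have h : UniversalEnvelopingAlgebra.lift ℂ so3Hom (algebraMap ℝ _ r) = algebraMap ℝ 𝔄 r :=
      AlgHom.commutes (UniversalEnvelopingAlgebra.lift ℂ so3Hom) (r : ℂ)
    rw [h]
    exact Subalgebra.algebraMap_mem _ r
  | add u v _ _ hu hv =>
    rw [map_add]
    exact add_mem hu hv
  | mul u v _ _ hu hv =>
    rw [map_mul]
    exact mul_mem hu hv

end So3
end RTGW
end

open RTGW RTGW.So3 in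
theorem theorem2 :
    Function.Injective co ∧
    (∀ k l : Fin 2, k ≠ l →
      Alg.x datum k * Alg.x datum l = co (μxx k l) * (Alg.x datum l * Alg.x datum k) ∧
      Alg.y datum k * Alg.y datum l = co (μyy k l) * (Alg.y datum l * Alg.y datum k) ∧
      Alg.x datum k * Alg.y datum l = co (μxy k l) * (Alg.y datum l * Alg.x datum k) ∧
      Alg.y datum k * Alg.x datum l = co (μyx k l) * (Alg.x datum l * Alg.y datum k)) ∧
    (U₁ ∈ Alg.fixed datum ∧ U₂ ∈ Alg.fixed datum ∧ U₃ ∈ Alg.fixed datum) ∧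
    (⁅U₁, U₂⁆ = U₃ ∧ ⁅U₃, U₁⁆ = U₂ ∧ ⁅U₃, U₂⁆ = -U₁) ∧
    (∃ ψ : UniversalEnvelopingAlgebra ℂ so3 →ₐ[ℂ] Alg.invariants datum,
      Function.Injective ψ ∧
      ((ψ (UniversalEnvelopingAlgebra.ι ℂ Lx) : 𝔄) = U₁ ∧
        (ψ (UniversalEnvelopingAlgebra.ι ℂ Ly) : 𝔄) = U₂ ∧
        (ψ (UniversalEnvelopingAlgebra.ι ℂ Lz) : 𝔄) = U₃) ∧
      ((Alg.invariants datum).val.comp ψ).range = Algebra.adjoin ℂ {U₁, U₂, U₃} ∧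
      (∀ u ∈ Algebra.adjoin ℝ {UniversalEnvelopingAlgebra.ι ℂ Lx,
          UniversalEnvelopingAlgebra.ι ℂ Ly, UniversalEnvelopingAlgebra.ι ℂ Lz},
        (ψ u : 𝔄) ∈ Alg.fixed datum) ∧
      ∃ e : so3 ≃ₗ⁅ℂ⁆ 𝔤, ∀ a : so3, (e a : 𝔄) = ψ (UniversalEnvelopingAlgebra.ι ℂ a)) ∧
    (Function.Injective (UniversalEnvelopingAlgebra.lift ℂ 𝔤.incl) ∧
      (UniversalEnvelopingAlgebra.lift ℂ 𝔤.incl).range ≤ Alg.invariants datum) := by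
  refine ⟨co_injective, fun k l h => ⟨x_mul_x h, y_mul_y h, x_mul_y h, y_mul_x h⟩,
    ⟨U₁_mem_fixed, U₂_mem_fixed, U₃_mem_fixed⟩, commutators,
    ⟨envelopingHom, envelopingHom_injective, ⟨?_, ?_, ?_⟩, ?_, fun u hu => envelopingHom_mem_fixed hu,
      so3Equiv, fun a => ?_⟩, lift_incl_injective, range_lift_incl_le⟩
  · rw [envelopingHom_ι, so3Hom_Lx]
  · rw [envelopingHom_ι, so3Hom_Ly]
  · rw [envelopingHom_ι, so3Hom_Lz]
  · exact range_lift_so3Hom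
  · rw [so3Equiv_apply, envelopingHom_ι]
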